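/- **Setting.** A discounted robust Markov decision process has states $\mathcal S=\{1,\dots,S\}$ and actions $\mathcal A=\{1,\dots,A\}$ ($S,A\ge 1$), a discount factor $\lambda\in(0,1)$, rewards $r_{sas'}\ge 0$, nominal transition probabilities $\overline{p}_{sa}\in\Delta_S$ with all $\overline p_{sas'}>0$, and an uncertainty budget $\kappa>0$, where $\Delta_n$ is the probability simplex in $\mathbb R^n$. The $s$-rectangular KL ambiguity set of state $s$ is $$\mathcal P_s=\Big\{p_s\in(\Delta_S)^A:\ \sum_{a\in\mathcal A}\sum_{s'\in\mathcal S}\overline p_{sas'}\,\phi\Big(\frac{p_{sas'}}{\overline p_{sas'}}\Big)\le\kappa\Big\},\qquad \phi(t)=t\log t-t+1\quad(0\log 0=0),$$ and the robust Bellman operator is $$[\mathfrak J(v)]_s=\max_{\pi_s\in\Delta_A}\ \min_{p_s\in\mathcal P_s}\ \sum_{a\in\mathcal A}\pi_{sa}\,p_{sa}^\top(r_{sa}+\lambda v),\qquad s\in\mathcal S .$$ Put $\overline R=(1-\lambda)^{-1}\max_{s,a,s'}r_{sas'}$ and $\min\overline p=\min_{s,a,s'}\overline p_{sas'}$. **Machine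 model.** Running time is the number of unit-cost operations of a real random-access machine: integer registers with addition, truncated subtraction, multiplication and comparison; arrays of real numbers addressed by integers; exact operations $+,-,\times,\div,\exp,\log$ and comparisons on reals; conversion of integers to reals but no rounding of reals to integers; and only natural numbers as constants in the program. **Statement.** There are a single program of this machine and a universal constant $C>0$ such that the following holds for all $S,A\ge 1$, all such data $(\lambda,r,\overline p,\kappa)$, every $\epsilon>0$ and every $v\in\mathbb R^S$ with $r_{sas'}+\lambda v_{s'}\ge 0$ for all $s,a,s'$ and $v_s\le\overline R$ for all $s$. On input $(S,A,\lambda,r,\overline p,\kappa,v,\epsilon)$ the program halts with an output $v'\in\mathbb R^S$ satisfying $\lVert v'-\mathfrak J(v)\rVert_\infty\le\epsilon$, after at most $$C\cdot S^2\cdot A\,\ell(A)\cdot \ell\!\left(\frac{\overline R^{\,2}\,\log(1/\min\overline p)}{\epsilon^2\kappa}\right)\cdot \ell\!\left(\frac{\overline R}{\epsilon}\right)$$ time units, where $\ell(x)=\max\{1,\log x\}$ for $x>0$ and $\ell(0)=1$. In particular, for parameters for which the logarithms are bounded away from zero, the time is $\mathcal O\big(S^2\cdot A\log A\cdot\log[\overline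 R^2\log(1/\min\overline p)/(\epsilon^2\kappa)]\cdot\log[\overline R/\epsilon]\big)$. -/

import Mathlib

/-! ## Real random-access machine

Programs are finite texts over integer index registers and arrays of real numbers. Integer
arithmetic, array access, the four arithmetic operations on reals, comparisons, `exp` and `log`
each cost one time unit. There is no rounding of reals to integers, and the only constants
that a program text can contain are natural numbers. -/

namespace RealRAM

/-- Memory: integer registers `idx i`, and real arrays with entries `mem k i`
(`k` the name of the array, `i` the position in it). -/
structure State where
  idx : ℕ → ℕ
  mem : ℕ → ℕ → ℝ

/-- Integer expressions. -/
inductive NExp where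
  | const (n : ℕ)
  | reg (i : ℕ)
  | add (e₁ e₂ : NExp)
  | sub (e₁ e₂ : NExp)
  | mul (e₁ e₂ : NExp)

/-- Value of an integer expression (subtraction is truncated at zero). -/
def NExp.eval (σ : State) : NExp → ℕ
  | .const n => n
  | .reg i => σ.idx i
  | .add e₁ e₂ => e₁.eval σ + e₂.eval σ
  | .sub e₁ e₂ => e₁.eval σ - e₂.eval σ
  | .mul e₁ e₂ => e₁.eval σ * e₂.eval σ

/-- Time to evaluate an integer expression: the number of its operations and accesses. -/
def NExp.cost : NExp → ℕ
  | .const _ => 1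
  | .reg _ => 1
  | .add e₁ e₂ => e₁.cost + e₂.cost + 1
  | .sub e₁ e₂ => e₁.cost + e₂.cost + 1
  | .mul e₁ e₂ => e₁.cost + e₂.cost + 1

/-- Real expressions. The array name in `get` is fixed in the program text, the position in the
array is computed at run time. -/
inductive RExp where
  | cast (e : NExp)
  | get (k : ℕ) (i : NExp)
  | add (e₁ e₂ : RExp)
  | sub (e₁ e₂ : RExp)
  | mul (e₁ e₂ : RExp)
  | div (e₁ e₂ : RExp)
  | exp (e : RExp)
  | log (e : RExp)

/-- Value of a real expression, in exact arithmetic. The operations are total: `x / 0 = 0`,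
`log 0 = 0` and `log x = log |x|`; a program can test for these cases. -/
noncomputable def RExp.eval (σ : State) : RExp → ℝ
  | .cast e => (e.eval σ : ℝ)
  | .get k i => σ.mem k (i.eval σ)
  | .add e₁ e₂ => e₁.eval σ + e₂.eval σ
  | .sub e₁ e₂ => e₁.eval σ - e₂.eval σ
  | .mul e₁ e₂ => e₁.eval σ * e₂.eval σ
  | .div e₁ e₂ => e₁.eval σ / e₂.eval σ
  | .exp e => Real.exp (e.eval σ)
  | .log e => Real.log (e.eval σ)

/-- Time to evaluate a real expression: the number of its operations and accesses. -/
def RExp.cost : RExp → ℕ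
  | .cast e => e.cost + 1
  | .get _ i => i.cost + 1
  | .add e₁ e₂ => e₁.cost + e₂.cost + 1
  | .sub e₁ e₂ => e₁.cost + e₂.cost + 1
  | .mul e₁ e₂ => e₁.cost + e₂.cost + 1
  | .div e₁ e₂ => e₁.cost + e₂.cost + 1
  | .exp e => e.cost + 1
  | .log e => e.cost + 1

/-- Comparisons `≤` and `<` of integers and of reals. -/
inductive Test where
  | nle (e₁ e₂ : NExp)
  | nlt (e₁ e₂ : NExp)
  | rle (e₁ e₂ : RExp)
  | rlt (e₁ e₂ : RExp)

/-- Truth of a comparison in a state. -/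
def Test.Holds (σ : State) : Test → Prop
  | .nle e₁ e₂ => e₁.eval σ ≤ e₂.eval σ
  | .nlt e₁ e₂ => e₁.eval σ < e₂.eval σ
  | .rle e₁ e₂ => e₁.eval σ ≤ e₂.eval σ
  | .rlt e₁ e₂ => e₁.eval σ < e₂.eval σ

/-- Time to evaluate a comparison. -/
def Test.cost : Test → ℕ
  | .nle e₁ e₂ => e₁.cost + e₂.cost + 1
  | .nlt e₁ e₂ => e₁.cost + e₂.cost + 1
  | .rle e₁ e₂ => e₁.cost + e₂.cost + 1
  | .rlt e₁ e₂ => e₁.cost + e₂.cost + 1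

/-- Programs. -/
inductive Prog where
  | skip
  | setIdx (i : ℕ) (e : NExp)
  | setMem (k : ℕ) (i : NExp) (e : RExp)
  | seq (P Q : Prog)
  | ite (b : Test) (P Q : Prog)
  | loop (b : Test) (P : Prog)

/-- Write the value `n` into the integer register `i`. -/
def State.writeIdx (σ : State) (i n : ℕ) : State :=
  { σ with idx := Function.update σ.idx i n }

/-- Write the real number `x` into position `i` of the array `k`. -/
noncomputable def State.writeMem (σ : State) (k i : ℕ) (x : ℝ) : State :=
  { σ with mem := Function.update σ.mem k (Function.update (σ.mem k) i x) }

/-- `Exec P σ σ' t`: started in `σ`, the program `P` halts in `σ'` after `t` time units.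
Here `loop b P` is `while b do P`. -/
inductive Exec : Prog → State → State → ℕ → Prop where
  | skip (σ : State) : Exec .skip σ σ 1
  | setIdx (i : ℕ) (e : NExp) (σ : State) :
      Exec (.setIdx i e) σ (σ.writeIdx i (e.eval σ)) (e.cost + 1)
  | setMem (k : ℕ) (i : NExp) (e : RExp) (σ : State) :
      Exec (.setMem k i e) σ (σ.writeMem k (i.eval σ) (e.eval σ)) (i.cost + e.cost + 1)
  | seq (P Q : Prog) (σ σ' σ'' : State) (t u : ℕ) :
      Exec P σ σ' t → Exec Q σ' σ'' u → Exec (.seq P Q) σ σ'' (t + u)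
  | ite_true (b : Test) (P Q : Prog) (σ σ' : State) (t : ℕ) :
      b.Holds σ → Exec P σ σ' t → Exec (.ite b P Q) σ σ' (b.cost + t)
  | ite_false (b : Test) (P Q : Prog) (σ σ' : State) (t : ℕ) :
      ¬ b.Holds σ → Exec Q σ σ' t → Exec (.ite b P Q) σ σ' (b.cost + t)
  | loop_true (b : Test) (P : Prog) (σ σ' σ'' : State) (t u : ℕ) :
      b.Holds σ → Exec P σ σ' t → Exec (.loop b P) σ' σ'' u →
        Exec (.loop b P) σ σ'' (b.cost + t + u)
  | loop_false (b : Test) (P : Prog) (σ : State) :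
      ¬ b.Holds σ → Exec (.loop b P) σ σ b.cost

end RealRAM

/-! ## Robust Markov decision processes with KL ambiguity sets -/

/-- Discounted robust MDP with `S` states, `A` actions and the `s`-rectangular KL ambiguity
set of budget `κ > 0` around strictly positive nominal transition probabilities. -/
structure KLRobustMDP (S A : ℕ) where
  /-- discount factor `λ` -/
  discount : ℝ
  discount_pos : 0 < discount
  discount_lt_one : discount < 1
  /-- rewards `r s a s'` -/
  reward : Fin S → Fin A → Fin S → ℝ
  reward_nonneg : ∀ s a s', 0 ≤ reward s a s'
  /-- nominal transition probabilities `p̄ s a s'` -/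
  nominal : Fin S → Fin A → Fin S → ℝ
  nominal_mem : ∀ s a, nominal s a ∈ stdSimplex ℝ (Fin S)
  nominal_pos : ∀ s a s', 0 < nominal s a s'
  /-- uncertainty budget `κ` -/
  budget : ℝ
  budget_pos : 0 < budget

/-- The `φ`-divergence `∑ q i * φ (p i / q i)` of `p` from `q`. -/
noncomputable def phiDivergence {S : ℕ} (φ : ℝ → ℝ) (p q : Fin S → ℝ) : ℝ :=
  ∑ i, q i * φ (p i / q i)

/-- KL divergence: the `φ`-divergence of `φ t = t * log t + 1 - t`. -/
noncomputable def klDistance {S : ℕ} (p q : Fin S → ℝ) : ℝ :=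
  phiDivergence InformationTheory.klFun p q

namespace KLRobustMDP

variable {S A : ℕ}

/-- The ambiguity set of state `s`: all tuples of transition probabilities whose KL divergences
from the nominal ones, summed over the actions, do not exceed the budget. -/
def ambiguitySet (M : KLRobustMDP S A) (s : Fin S) : Set (Fin A → Fin S → ℝ) :=
  {p | (∀ a, p a ∈ stdSimplex ℝ (Fin S)) ∧
    ∑ a, klDistance (p a) (M.nominal s a) ≤ M.budget}

/-- The robust Bellman operator
`J(v) s = max_π min_p ∑ a, π a * ∑ s', p a s' * (r s a s' + λ * v s')`, where `π` runs over the
simplex and `p` over the ambiguity set of `s`. Both are non-empty and compact and the objective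
is continuous, so that the supremum and the infimum are a maximum and a minimum. -/
noncomputable def bellman (M : KLRobustMDP S A) (v : Fin S → ℝ) (s : Fin S) : ℝ :=
  ⨆ π : stdSimplex ℝ (Fin A), ⨅ p : M.ambiguitySet s,
    ∑ a, (π : Fin A → ℝ) a *
      ∑ s', (p : Fin A → Fin S → ℝ) a s' * (M.reward s a s' + M.discount * v s')

/-- `R̄ = max r / (1 - λ)`. -/
noncomputable def rewardBound (M : KLRobustMDP S A) : ℝ :=
  (1 - M.discount)⁻¹ * ⨆ i : Fin S × Fin A × Fin S, M.reward i.1 i.2.1 i.2.2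

/-- `min p̄`, the smallest nominal transition probability. -/
noncomputable def minNominal (M : KLRobustMDP S A) : ℝ :=
  ⨅ i : Fin S × Fin A × Fin S, M.nominal i.1 i.2.1 i.2.2

/-- Row-major layout: the entry `f s a s'` stands at position `(s * A + a) * S + s'`. -/
def flatten (f : Fin S → Fin A → Fin S → ℝ) (i : ℕ) : ℝ :=
  if h : i < S * A * S then
    f (finProdFinEquiv.symm (finProdFinEquiv.symm ⟨i, h⟩).1).1
      (finProdFinEquiv.symm (finProdFinEquiv.symm ⟨i, h⟩).1).2
      (finProdFinEquiv.symm ⟨i, h⟩).2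
  else 0

/-- Initial memory. Registers `0` and `1` hold `S` and `A`; array `0` holds the nominal
probabilities, array `1` the rewards, array `2` the vector `v`, and array `3` the three numbers
`λ, κ, ε`. Everything else is zero. -/
def input (M : KLRobustMDP S A) (v : Fin S → ℝ) (ε : ℝ) : RealRAM.State where
  idx i := match i with
    | 0 => S
    | 1 => A
    | _ => 0
  mem k i := match k, i with
    | 0, i => flatten M.nominal i
    | 1, i => flatten M.reward i
    | 2, i => if h : i < S then v ⟨i, h⟩ else 0
    | 3, 0 => M.discount
    | 3, 1 => M.budget
    | 3, 2 => ε
    | _, _ => 0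

end KLRobustMDP

/-- The output vector, read from the first `S` positions of array `4`. -/
def RealRAM.State.output (σ : RealRAM.State) (S : ℕ) : Fin S → ℝ :=
  fun s => σ.mem 4 s

/-!
Write `b s' = r s a s' + λ * v s'` for the payoffs of action `a` in a fixed state `s`, and `q` for
its nominal distribution. The program finds the robust value `J = (bellman v) s` by a bisection
on candidates `β`. The smallest divergence of a distribution with mean payoff at most `β` from
`q` is the maximum over `θ ≥ 0` of the concave dual function
`dualValue q b β θ = -θ * β - log (∑ q * exp (-θ * b))`, and `J` is the least `β` at which these
divergences, summed over the actions, fit into the budget `κ`. The derivative of the dual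
function is the difference of the mean of `b` under the tilt of `q` by `exp (-θ * b)` and `β`, so
that an inner bisection on its sign finds the maximiser.

No minimax theorem is needed. If the dual values of some multipliers `θ a ≥ 0` add up to at least
`κ`, then the policy proportional to `θ` guarantees `β`, by the Gibbs variational inequality
(`le_bellman_of_budget_le`). If they fall short of `κ`, then the exact maximisers, which the inner
bisection has bracketed, define tilts with mean payoff at most `β`, whose divergences exceed the
dual values by at most the length of the bracket times the largest payoff
(`exists_klDistance_le_dualValue_add`). Mixing in a small proportion of the nominal
distributions makes them feasible, at the price of `ε / 2` in the payoff
(`bellman_le_of_klDistance_le`).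

Let `B ≤ R̄` be the largest payoff and `base ≤ J` the largest over the actions of the smallest
payoffs. While the outer bracket is longer than `ε / 2`, its midpoint exceeds `base` by at least
`ε / 4`, and then the maximisers are at most `4 * log (1 / min p̄) / ε` (`tiltedSum_le_of_log_le`).
A bracket of length `ε * κ / (2 * A * B ^ 2)` is precise enough, so that
`log₂ (8 * A * R̄ ^ 2 * log (1 / min p̄) / (ε ^ 2 * κ))` inner halvings suffice, each of them in
time `O(S)`, for each of the `A` actions in each of `log₂ (2 * R̄ / ε)` outer halvings.
-/

/-! ### Execution of programs -/

namespace RealRAM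

/-- `Runs P σ R`: started in `σ`, the program `P` halts, and its final state and running time
satisfy `R`. -/
def Runs (P : Prog) (σ : State) (R : State → ℕ → Prop) : Prop :=
  ∃ σ' t, Exec P σ σ' t ∧ R σ' t

theorem Runs.mono {P : Prog} {σ : State} {R R' : State → ℕ → Prop} (h : Runs P σ R)
    (hR : ∀ σ' t, R σ' t → R' σ' t) : Runs P σ R' := by
  obtain ⟨σ', t, hE, hr⟩ := h
  exact ⟨σ', t, hE, hR _ _ hr⟩

@[simp]
theorem runs_skip {σ : State} {R : State → ℕ → Prop} : Runs .skip σ R ↔ R σ 1 := by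
  constructor
  · rintro ⟨σ', t, hE, hr⟩
    cases hE
    exact hr
  · exact fun h => ⟨_, _, .skip σ, h⟩

@[simp]
theorem runs_setIdx {i : ℕ} {e : NExp} {σ : State} {R : State → ℕ → Prop} :
    Runs (.setIdx i e) σ R ↔ R (σ.writeIdx i (e.eval σ)) (e.cost + 1) := by
  constructor
  · rintro ⟨σ', t, hE, hr⟩
    cases hE
    exact hr
  · exact fun h => ⟨_, _, .setIdx i e σ, h⟩

@[simp]
theorem runs_setMem {k : ℕ} {i : NExp} {e : RExp} {σ : State} {R : State → ℕ → Prop} :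
    Runs (.setMem k i e) σ R ↔
      R (σ.writeMem k (i.eval σ) (e.eval σ)) (i.cost + e.cost + 1) := by
  constructor
  · rintro ⟨σ', t, hE, hr⟩
    cases hE
    exact hr
  · exact fun h => ⟨_, _, .setMem k i e σ, h⟩

@[simp]
theorem runs_seq {P Q : Prog} {σ : State} {R : State → ℕ → Prop} :
    Runs (.seq P Q) σ R ↔
      Runs P σ fun σ' t => Runs Q σ' fun σ'' u => R σ'' (t + u) := by
  constructor
  · rintro ⟨σ', t, hE, hr⟩
    cases hE with
    | seq _ _ _ σ₁ _ t u h₁ h₂ => exact ⟨_, _, h₁, _, _, h₂, hr⟩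
  · rintro ⟨_, _, h₁, _, _, h₂, hr⟩
    exact ⟨_, _, .seq _ _ _ _ _ _ _ h₁ h₂, hr⟩

@[simp]
theorem runs_ite {b : Test} {P Q : Prog} {σ : State} {R : State → ℕ → Prop} :
    Runs (.ite b P Q) σ R ↔
      (b.Holds σ → Runs P σ fun σ' t => R σ' (b.cost + t)) ∧
      (¬ b.Holds σ → Runs Q σ fun σ' t => R σ' (b.cost + t)) := by
  constructor
  · rintro ⟨σ', t, hE, hr⟩
    cases hE with
    | ite_true _ _ _ _ _ _ hb h => exact ⟨fun _ => ⟨_, _, h, hr⟩, fun h' => absurd hb h'⟩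
    | ite_false _ _ _ _ _ _ hb h => exact ⟨fun h' => absurd h' hb, fun _ => ⟨_, _, h, hr⟩⟩
  · rintro ⟨h₁, h₂⟩
    by_cases hb : b.Holds σ
    · obtain ⟨_, _, h, hr⟩ := h₁ hb
      exact ⟨_, _, .ite_true _ _ _ _ _ _ hb h, hr⟩
    · obtain ⟨_, _, h, hr⟩ := h₂ hb
      exact ⟨_, _, .ite_false _ _ _ _ _ _ hb h, hr⟩

/-- Rule for `while` loops: `I k` holds after `k` rounds, a round costs at most `T`, and the
condition fails after `K` rounds at the latest. -/
theorem runs_loop {b : Test} {P : Prog} {σ : State} (I : ℕ → State → Prop) (K T : ℕ)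
    (h0 : I 0 σ)
    (hstep : ∀ k τ, k < K → I k τ → b.Holds τ → Runs P τ fun τ' t => I (k + 1) τ' ∧ t ≤ T)
    (hK : ∀ τ, I K τ → ¬ b.Holds τ) :
    Runs (.loop b P) σ fun τ t =>
      (∃ k ≤ K, I k τ) ∧ ¬ b.Holds τ ∧ t ≤ K * (b.cost + T) + b.cost := by
  suffices H : ∀ n k τ, k + n = K → I k τ → Runs (.loop b P) τ fun τ t =>
      (∃ k ≤ K, I k τ) ∧ ¬ b.Holds τ ∧ t ≤ n * (b.cost + T) + b.cost from
    H K 0 σ (zero_add K) h0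
  intro n
  induction n with
  | zero =>
    intro k τ hk hI
    obtain rfl : k = K := by omega
    exact ⟨_, _, .loop_false _ _ _ (hK τ hI), ⟨k, le_rfl, hI⟩, hK τ hI, by omega⟩
  | succ n ih =>
    intro k τ hk hI
    by_cases hb : b.Holds τ
    · obtain ⟨τ₁, t, hE, hI₁, ht⟩ := hstep k τ (by omega) hI hb
      obtain ⟨τ₂, u, hE₂, hI₂, hb₂, hu⟩ := ih (k + 1) τ₁ (by omega) hI₁
      refine ⟨_, _, .loop_true _ _ _ _ _ _ _ hb hE hE₂, hI₂, hb₂, ?_⟩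
      rw [add_mul, one_mul]
      omega
    · exact ⟨_, _, .loop_false _ _ _ hb, ⟨k, by omega, hI⟩, hb, by omega⟩

end RealRAM

/-! ### Duality for the projection problem -/

/-- The partition function `∑ i, q i * exp (-θ * b i)` of the exponential tilts of `q`. -/
noncomputable def partitionFn {S : ℕ} (q b : Fin S → ℝ) (θ : ℝ) : ℝ :=
  ∑ i, q i * Real.exp (-(θ * b i))

/-- The unnormalised mean `∑ i, q i * exp (-θ * b i) * b i` of `b` under the tilt of `q`. -/
noncomputable def tiltedSum {S : ℕ} (q b : Fin S → ℝ) (θ : ℝ) : ℝ :=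
  ∑ i, q i * Real.exp (-(θ * b i)) * b i

/-- The Lagrangian dual function at `θ` of the projection problem
`min {klDistance p q | ∑ i, p i * b i ≤ β}`. -/
noncomputable def dualValue {S : ℕ} (q b : Fin S → ℝ) (β θ : ℝ) : ℝ :=
  -(θ * β) - Real.log (partitionFn q b θ)

section Projection

variable {S : ℕ} {q b : Fin S → ℝ}

theorem nonempty_of_mem_stdSimplex (hq : q ∈ stdSimplex ℝ (Fin S)) :
    (Finset.univ : Finset (Fin S)).Nonempty := by
  rw [Finset.nonempty_iff_ne_empty]
  intro h
  have := hq.2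
  simp [h] at this

theorem partitionFn_pos (hq : q ∈ stdSimplex ℝ (Fin S)) (hq0 : ∀ i, 0 < q i) (θ : ℝ) :
    0 < partitionFn q b θ :=
  Finset.sum_pos (fun i _ => mul_pos (hq0 i) (Real.exp_pos _)) (nonempty_of_mem_stdSimplex hq)

theorem partitionFn_zero (hq : q ∈ stdSimplex ℝ (Fin S)) : partitionFn q b 0 = 1 := by
  simpa [partitionFn] using hq.2

theorem dualValue_zero (hq : q ∈ stdSimplex ℝ (Fin S)) (β : ℝ) : dualValue q b β 0 = 0 := by
  simp [dualValue, partitionFn_zero hq]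

theorem continuous_partitionFn : Continuous (partitionFn q b) := by
  unfold partitionFn
  fun_prop

theorem continuous_tiltedSum : Continuous (tiltedSum q b) := by
  unfold tiltedSum
  fun_prop

/-- Young's inequality for the conjugate pair `klFun` and `exp - 1`. -/
theorem mul_sub_exp_add_one_le_klFun {x : ℝ} (hx : 0 ≤ x) (y : ℝ) :
    x * y - Real.exp y + 1 ≤ InformationTheory.klFun x := by
  rw [InformationTheory.klFun_apply]
  rcases hx.eq_or_lt with rfl | hx
  · have := Real.exp_pos y
    simp
    linarith
  · have h := Real.log_le_sub_one_of_pos (div_pos (Real.exp_pos y) hx)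
    rw [Real.log_div (Real.exp_pos y).ne' hx.ne', Real.log_exp] at h
    have h2 := mul_le_mul_of_nonneg_left h hx.le
    have h3 : x * (Real.exp y / x - 1) = Real.exp y - x := by field_simp
    nlinarith

theorem klDistance_nonneg (hq0 : ∀ i, 0 < q i) {p : Fin S → ℝ} (hp : ∀ i, 0 ≤ p i) :
    0 ≤ klDistance p q := by
  unfold klDistance phiDivergence
  exact Finset.sum_nonneg fun i _ => mul_nonneg (hq0 i).le
    (InformationTheory.klFun_nonneg (div_nonneg (hp i) (hq0 i).le))

theorem klDistance_self (hq0 : ∀ i, 0 < q i) : klDistance q q = 0 := by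
  unfold klDistance phiDivergence
  refine Finset.sum_eq_zero fun i _ => ?_
  rw [div_self (hq0 i).ne', InformationTheory.klFun_one, mul_zero]

/-- The Gibbs variational inequality, that is, weak duality for the projection problem. -/
theorem neg_mul_sub_log_le_klDistance (hq : q ∈ stdSimplex ℝ (Fin S)) (hq0 : ∀ i, 0 < q i)
    {p : Fin S → ℝ} (hp : p ∈ stdSimplex ℝ (Fin S)) (θ : ℝ) :
    -(θ * ∑ i, p i * b i) - Real.log (partitionFn q b θ) ≤ klDistance p q := by
  set Z := partitionFn q b θ with hZ
  have hZ0 : 0 < Z := partitionFn_pos hq hq0 θ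
  have key : ∀ i, p i * (-(θ * b i) - Real.log Z) - q i * Real.exp (-(θ * b i)) / Z + q i
      ≤ q i * InformationTheory.klFun (p i / q i) := by
    intro i
    have h := mul_le_mul_of_nonneg_left (mul_sub_exp_add_one_le_klFun
      (div_nonneg (hp.1 i) (hq0 i).le) (-(θ * b i) - Real.log Z)) (hq0 i).le
    rw [Real.exp_sub, Real.exp_log hZ0] at h
    refine le_of_eq_of_le ?_ h
    have h2 := (hq0 i).ne'
    field_simp
  have hsum := Finset.sum_le_sum fun i (_ : i ∈ Finset.univ) => key i
  rw [Finset.sum_add_distrib, Finset.sum_sub_distrib, ← Finset.sum_div, hq.2] at hsum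
  have h1 : (∑ i, q i * Real.exp (-(θ * b i))) / Z = 1 := div_self hZ0.ne'
  have h2 : ∑ i, p i * (-(θ * b i) - Real.log Z) = -(θ * ∑ i, p i * b i) - Real.log Z := by
    simp only [mul_sub, Finset.sum_sub_distrib, ← Finset.sum_mul, hp.2, Finset.mul_sum,
      ← Finset.sum_neg_distrib, one_mul]
    congr 1
    exact Finset.sum_congr rfl fun i _ => by ring
  rw [h1, h2] at hsum
  unfold klDistance phiDivergence
  linarith

/-- The exponential tilt of `q`. -/
noncomputable def tilt (q b : Fin S → ℝ) (θ : ℝ) (i : Fin S) : ℝ :=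
  q i * Real.exp (-(θ * b i)) / partitionFn q b θ

theorem tilt_mem (hq : q ∈ stdSimplex ℝ (Fin S)) (hq0 : ∀ i, 0 < q i) (θ : ℝ) :
    tilt q b θ ∈ stdSimplex ℝ (Fin S) := by
  have hZ0 : 0 < partitionFn q b θ := partitionFn_pos hq hq0 θ
  refine ⟨fun i => div_nonneg (mul_nonneg (hq0 i).le (Real.exp_pos _).le) hZ0.le, ?_⟩
  unfold tilt
  rw [← Finset.sum_div]
  exact div_self hZ0.ne'

theorem sum_tilt_mul (θ : ℝ) :
    ∑ i, tilt q b θ i * b i = tiltedSum q b θ / partitionFn q b θ := by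
  unfold tiltedSum
  rw [Finset.sum_div]
  exact Finset.sum_congr rfl fun i _ => by unfold tilt; ring

/-- The Gibbs variational inequality is an equality at the tilt. -/
theorem klDistance_tilt (hq : q ∈ stdSimplex ℝ (Fin S)) (hq0 : ∀ i, 0 < q i) (θ : ℝ) :
    klDistance (tilt q b θ) q =
      -(θ * ∑ i, tilt q b θ i * b i) - Real.log (partitionFn q b θ) := by
  set Z := partitionFn q b θ with hZ
  have hZ0 : 0 < Z := partitionFn_pos hq hq0 θ
  have key : ∀ i, q i * InformationTheory.klFun (tilt q b θ i / q i) =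
      tilt q b θ i * (-(θ * b i) - Real.log Z) + q i - tilt q b θ i := by
    intro i
    have h1 : tilt q b θ i / q i = Real.exp (-(θ * b i)) / Z := by
      have := (hq0 i).ne'
      unfold tilt
      rw [← hZ]
      field_simp
    have h2 : tilt q b θ i = q i * (Real.exp (-(θ * b i)) / Z) := by
      unfold tilt
      rw [← hZ]
      ring
    rw [h1, h2, InformationTheory.klFun_apply, Real.log_div (Real.exp_pos _).ne' hZ0.ne',
      Real.log_exp]
    ring
  unfold klDistance phiDivergence
  simp only [key, Finset.sum_sub_distrib, Finset.sum_add_distrib, mul_sub, ← Finset.sum_mul,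
    (tilt_mem hq hq0 θ).2, hq.2, Finset.mul_sum, ← Finset.sum_neg_distrib, one_mul]
  rw [add_sub_cancel_right]
  congr 1
  exact Finset.sum_congr rfl fun i _ => by ring

/-- Moving from `p` towards the nominal distribution shrinks the divergence linearly. -/
theorem klDistance_mix_le (hq0 : ∀ i, 0 < q i) {p : Fin S → ℝ} (hp : ∀ i, 0 ≤ p i) {t : ℝ}
    (ht0 : 0 ≤ t) (ht1 : t ≤ 1) :
    klDistance (fun i => (1 - t) * p i + t * q i) q ≤ (1 - t) * klDistance p q := by
  unfold klDistance phiDivergence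
  rw [Finset.mul_sum]
  refine Finset.sum_le_sum fun i _ => ?_
  have h1 : ((1 - t) * p i + t * q i) / q i = (1 - t) * (p i / q i) + t * 1 := by
    have := (hq0 i).ne'
    field_simp
  have h2 := InformationTheory.convexOn_klFun.2
    (Set.mem_Ici.2 (div_nonneg (hp i) (hq0 i).le)) (Set.mem_Ici.2 zero_le_one)
    (sub_nonneg.2 ht1) ht0 (by ring)
  simp only [smul_eq_mul, InformationTheory.klFun_one, mul_zero, add_zero] at h2
  rw [h1]
  nlinarith [mul_le_mul_of_nonneg_left h2 (hq0 i).le]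

/-- A multiplier beyond which the tilted mean lies below `β`: the divergence of the tilt is
nonnegative, and the partition function is at least `q j * exp (-θ * c)`. -/
theorem tiltedSum_le_of_log_le (hq : q ∈ stdSimplex ℝ (Fin S)) (hq0 : ∀ i, 0 < q i)
    {β c m θ : ℝ} (hθ : 0 ≤ θ) {j : Fin S} (hm : 0 < m) (hmq : m ≤ q j) (hj : b j ≤ c)
    (hc : c < β) (h : -Real.log m ≤ θ * (β - c)) :
    tiltedSum q b θ ≤ β * partitionFn q b θ := by
  have hZ0 : 0 < partitionFn q b θ := partitionFn_pos hq hq0 θ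
  rcases hθ.eq_or_lt with rfl | hθ
  · -- here `m ≥ 1`, so that `q` is concentrated in `j`
    have hm1 : 1 ≤ m := by
      by_contra! hlt
      have := Real.log_neg hm hlt
      linarith
    have hle : ∀ i, i ≠ j → q i ≤ 0 := by
      intro i hi
      have h3 : q i + q j ≤ ∑ k, q k := by
        rw [← Finset.sum_pair hi]
        exact Finset.sum_le_sum_of_subset_of_nonneg (Finset.subset_univ _)
          fun k _ _ => (hq0 k).le
      rw [hq.2] at h3
      linarith
    have huniq : ∀ i, i = j := fun i => by
      by_contra hi
      exact absurd (hle i hi) (not_le.2 (hq0 i))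
    rw [partitionFn_zero hq]
    have h4 : tiltedSum q b 0 = ∑ i, q i * b i := by simp [tiltedSum]
    have h5 : ∑ i, q i * b i ≤ ∑ i, q i * c := Finset.sum_le_sum fun i _ => by
      rw [huniq i]
      exact mul_le_mul_of_nonneg_left hj (hq0 j).le
    rw [← Finset.sum_mul, hq.2] at h5
    linarith
  · have hkl := klDistance_nonneg hq0 (tilt_mem (b := b) hq hq0 θ).1
    rw [klDistance_tilt hq hq0, sum_tilt_mul] at hkl
    have hZ : m * Real.exp (-(θ * c)) ≤ partitionFn q b θ := by
      refine le_trans ?_ (Finset.single_le_sum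
        (fun i _ => (mul_pos (hq0 i) (Real.exp_pos (-(θ * b i)))).le) (Finset.mem_univ j))
      gcongr
      exact (hq0 j).le
    have hlog := Real.log_le_log (mul_pos hm (Real.exp_pos _)) hZ
    rw [Real.log_mul hm.ne' (Real.exp_pos _).ne', Real.log_exp] at hlog
    rw [← div_le_iff₀ hZ0]
    have : θ * (tiltedSum q b θ / partitionFn q b θ) ≤ θ * β := by linarith
    exact le_of_mul_le_mul_left this hθ

/-- If the optimal multiplier is bracketed by `lo` and `hi`, then the value of the projection
problem exceeds the dual value at `lo` by at most `B * (hi - lo)`. -/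
theorem exists_klDistance_le_dualValue_add (hq : q ∈ stdSimplex ℝ (Fin S))
    (hq0 : ∀ i, 0 < q i) {B β lo hi δ : ℝ} (hb0 : ∀ i, 0 ≤ b i) (hbB : ∀ i, b i ≤ B)
    (hβ : 0 ≤ β) (hlohi : lo ≤ hi)
    (hlo : lo = 0 ∨ β * partitionFn q b lo ≤ tiltedSum q b lo)
    (hhi : tiltedSum q b hi ≤ β * partitionFn q b hi) (hδ : B * (hi - lo) ≤ δ) :
    ∃ p ∈ stdSimplex ℝ (Fin S), ∑ i, p i * b i ≤ β ∧
      klDistance p q ≤ dualValue q b β lo + δ := by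
  have hB0 : 0 ≤ B := by
    obtain ⟨i, -⟩ := nonempty_of_mem_stdSimplex hq
    exact (hb0 i).trans (hbB i)
  by_cases hc : β * partitionFn q b lo ≤ tiltedSum q b lo
  · have hcont : Continuous fun θ => tiltedSum q b θ - β * partitionFn q b θ :=
      continuous_tiltedSum.sub (continuous_const.mul continuous_partitionFn)
    obtain ⟨θ, ⟨hθ1, hθ2⟩, hθ⟩ := intermediate_value_Icc' hlohi hcont.continuousOn
      (show (0 : ℝ) ∈ Set.Icc _ _ from ⟨by simpa using hhi, by simpa using hc⟩)
    have hZ0 : 0 < partitionFn q b θ := partitionFn_pos hq hq0 θ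
    have hmean : ∑ i, tilt q b θ i * b i = β := by
      rw [sum_tilt_mul, div_eq_iff hZ0.ne']
      simpa [sub_eq_zero] using hθ
    refine ⟨tilt q b θ, tilt_mem hq hq0 θ, hmean.le, ?_⟩
    rw [klDistance_tilt hq hq0, hmean, dualValue]
    -- no exponential `exp (-θ * b i)` shrinks by a larger factor between `lo` and `θ`
    have hZle : partitionFn q b lo ≤ Real.exp (B * (θ - lo)) * partitionFn q b θ := by
      unfold partitionFn
      rw [Finset.mul_sum]
      refine Finset.sum_le_sum fun i _ => ?_
      rw [mul_left_comm, ← Real.exp_add]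
      refine mul_le_mul_of_nonneg_left (Real.exp_le_exp.2 ?_) (hq0 i).le
      nlinarith [mul_le_mul_of_nonneg_right (hbB i) (sub_nonneg.2 hθ1)]
    have hlog := Real.log_le_log (partitionFn_pos hq hq0 lo) hZle
    rw [Real.log_mul (Real.exp_pos _).ne' hZ0.ne', Real.log_exp] at hlog
    nlinarith [mul_le_mul_of_nonneg_left hθ2 hB0, mul_le_mul_of_nonneg_right hθ1 hβ]
  · obtain rfl : lo = 0 := hlo.resolve_right hc
    -- the nominal distribution itself meets the constraint
    refine ⟨q, hq, ?_, ?_⟩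
    · rw [partitionFn_zero hq] at hc
      have h4 : tiltedSum q b 0 = ∑ i, q i * b i := by simp [tiltedSum]
      linarith
    · rw [klDistance_self hq0, dualValue_zero hq]
      nlinarith [mul_nonneg hB0 (sub_nonneg.2 hlohi)]

end Projection

/-! ### Bounds on the robust Bellman operator -/

namespace KLRobustMDP

variable {S A : ℕ} (M : KLRobustMDP S A) (v : Fin S → ℝ)

/-- The payoff `r s a s' + λ * v s'` of the transition from `s` to `s'` under action `a`. -/
noncomputable def payoff (s : Fin S) (a : Fin A) (s' : Fin S) : ℝ :=
  M.reward s a s' + M.discount * v s'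

variable {M v}

theorem nominal_mem_ambiguitySet (s : Fin S) : M.nominal s ∈ M.ambiguitySet s := by
  refine ⟨M.nominal_mem s, ?_⟩
  simp only [klDistance_self (M.nominal_pos s _), Finset.sum_const_zero]
  exact M.budget_pos.le

section Bellman

variable {s : Fin S} (hb0 : ∀ a s', 0 ≤ M.payoff v s a s')
include hb0

theorem objective_nonneg {π : Fin A → ℝ} (hπ : ∀ a, 0 ≤ π a) {p : Fin A → Fin S → ℝ}
    (hp : p ∈ M.ambiguitySet s) :
    0 ≤ ∑ a, π a * ∑ s', p a s' * (M.reward s a s' + M.discount * v s') :=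
  Finset.sum_nonneg fun a _ => mul_nonneg (hπ a) (Finset.sum_nonneg fun s' _ =>
    mul_nonneg ((hp.1 a).1 s') (hb0 a s'))

/-- A single feasible `p`, good against every action, bounds the Bellman operator from above. -/
theorem bellman_le_of_mem (hA : 0 < A) {p : Fin A → Fin S → ℝ} (hp : p ∈ M.ambiguitySet s)
    {x : ℝ} (hx : ∀ a, ∑ s', p a s' * M.payoff v s a s' ≤ x) : M.bellman v s ≤ x := by
  have : Nonempty (stdSimplex ℝ (Fin A)) := ⟨⟨_, single_mem_stdSimplex ℝ (⟨0, hA⟩ : Fin A)⟩⟩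
  refine ciSup_le fun π => ?_
  refine (ciInf_le ⟨0, ?_⟩ ⟨p, hp⟩).trans ?_
  · rintro _ ⟨p', rfl⟩
    exact objective_nonneg hb0 π.2.1 p'.2
  · calc _ ≤ ∑ a, (π : Fin A → ℝ) a * x :=
          Finset.sum_le_sum fun a _ => mul_le_mul_of_nonneg_left (hx a) (π.2.1 a)
      _ = x := by
          have h1 : ∑ a, (π : Fin A → ℝ) a = 1 := π.2.2
          rw [← Finset.sum_mul, h1, one_mul]

/-- A single policy, good against every feasible `p`, bounds the Bellman operator from below. -/
theorem le_bellman_of_mem {π : Fin A → ℝ} (hπ : π ∈ stdSimplex ℝ (Fin A)) {x : ℝ}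
    (hx : ∀ p ∈ M.ambiguitySet s, x ≤ ∑ a, π a * ∑ s', p a s' * M.payoff v s a s') :
    x ≤ M.bellman v s := by
  have : Nonempty (M.ambiguitySet s) := ⟨⟨_, nominal_mem_ambiguitySet s⟩⟩
  refine (le_ciInf fun p : M.ambiguitySet s => hx p p.2).trans ?_
  refine le_ciSup (f := fun π : stdSimplex ℝ (Fin A) => ⨅ p : M.ambiguitySet s,
    ∑ a, (π : Fin A → ℝ) a *
      ∑ s', (p : Fin A → Fin S → ℝ) a s' * (M.reward s a s' + M.discount * v s'))
    ⟨∑ a, ∑ s', M.nominal s a s' * M.payoff v s a s', ?_⟩ ⟨π, hπ⟩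
  rintro _ ⟨π', rfl⟩
  refine (ciInf_le ⟨0, ?_⟩ ⟨_, nominal_mem_ambiguitySet s⟩).trans
    (Finset.sum_le_sum fun a _ => ?_)
  · rintro _ ⟨p', rfl⟩
    exact objective_nonneg hb0 π'.2.1 p'.2
  · have h1 : (π' : Fin A → ℝ) a ≤ 1 := by
      rw [← show ∑ a, (π' : Fin A → ℝ) a = 1 from π'.2.2]
      exact Finset.single_le_sum (fun a _ => π'.2.1 a) (Finset.mem_univ a)
    exact mul_le_of_le_one_left (Finset.sum_nonneg fun s' _ =>
      mul_nonneg (M.nominal_pos s a s').le (hb0 a s')) h1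

/-- Weak duality: multipliers whose dual values add up to the budget define, after
normalisation, a policy that guarantees `β`. -/
theorem le_bellman_of_budget_le {β : ℝ} {θ : Fin A → ℝ} (hθ : ∀ a, 0 ≤ θ a)
    (h : M.budget ≤ ∑ a, dualValue (M.nominal s a) (M.payoff v s a) β (θ a)) :
    β ≤ M.bellman v s := by
  have hpos : 0 < ∑ a, θ a := by
    refine (Finset.sum_nonneg fun a _ => hθ a).lt_of_ne fun h0 => ?_
    have hz := (Finset.sum_eq_zero_iff_of_nonneg fun a _ => hθ a).1 h0.symm
    rw [Finset.sum_eq_zero fun a ha => by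
      rw [hz a ha]
      exact dualValue_zero (M.nominal_mem s a) β] at h
    exact absurd M.budget_pos (not_lt.2 h)
  refine le_bellman_of_mem hb0 (π := fun a => θ a / ∑ a, θ a)
    ⟨fun a => div_nonneg (hθ a) hpos.le, by rw [← Finset.sum_div, div_self hpos.ne']⟩ ?_
  intro p hp
  have h1 := Finset.sum_le_sum fun a (_ : a ∈ Finset.univ) =>
    neg_mul_sub_log_le_klDistance (b := M.payoff v s a) (M.nominal_mem s a)
      (M.nominal_pos s a) (hp.1 a) (θ a)
  have h2 := h.trans' (h1.trans hp.2)
  simp only [dualValue, Finset.sum_sub_distrib, Finset.sum_neg_distrib,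
    ← Finset.sum_mul] at h2
  simp only [div_mul_eq_mul_div, ← Finset.sum_div]
  rw [le_div_iff₀ hpos]
  linarith

/-- Transition probabilities that exceed the budget by at most `δ` become feasible when a
proportion `δ / (κ + δ)` of the nominal ones is mixed in. -/
theorem bellman_le_of_klDistance_le (hA : 0 < A) {B β δ η : ℝ}
    (hbB : ∀ a s', M.payoff v s a s' ≤ B) (hβ : 0 ≤ β) (hδ : 0 ≤ δ)
    (hδη : δ * B ≤ M.budget * η) (hη : 0 ≤ η) {p : Fin A → Fin S → ℝ}
    (hp : ∀ a, p a ∈ stdSimplex ℝ (Fin S))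
    (hpβ : ∀ a, ∑ s', p a s' * M.payoff v s a s' ≤ β)
    (hkl : ∑ a, klDistance (p a) (M.nominal s a) ≤ M.budget + δ) :
    M.bellman v s ≤ β + η := by
  have hκ := M.budget_pos
  have hκδ : 0 < M.budget + δ := by linarith
  set t := δ / (M.budget + δ) with ht
  have ht0 : 0 ≤ t := div_nonneg hδ hκδ.le
  have ht1 : t ≤ 1 := (div_le_one hκδ).2 (by linarith)
  have htκ : (1 - t) * (M.budget + δ) = M.budget := by
    rw [ht]
    field_simp
    ring
  refine bellman_le_of_mem hb0 hA
    (p := fun a s' => (1 - t) * p a s' + t * M.nominal s a s') ⟨fun a => ?_, ?_⟩ fun a => ?_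
  · exact convex_stdSimplex ℝ (Fin S) (hp a) (M.nominal_mem s a) (sub_nonneg.2 ht1) ht0 (by ring)
  · calc _ ≤ ∑ a, (1 - t) * klDistance (p a) (M.nominal s a) :=
          Finset.sum_le_sum fun a _ =>
            klDistance_mix_le (M.nominal_pos s a) (hp a).1 ht0 ht1
      _ ≤ (1 - t) * (M.budget + δ) := by
          rw [← Finset.mul_sum]
          exact mul_le_mul_of_nonneg_left hkl (sub_nonneg.2 ht1)
      _ = M.budget := htκ
  · have h1 : ∑ s', M.nominal s a s' * M.payoff v s a s' ≤ B := by
      calc _ ≤ ∑ s', M.nominal s a s' * B := Finset.sum_le_sum fun s' _ =>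
            mul_le_mul_of_nonneg_left (hbB a s') (M.nominal_pos s a s').le
        _ = B := by rw [← Finset.sum_mul, (M.nominal_mem s a).2, one_mul]
    have h2 : t * B ≤ η := by
      rw [ht, div_mul_eq_mul_div, div_le_iff₀ hκδ]
      nlinarith
    have h3 := mul_le_mul_of_nonneg_left (hpβ a) (sub_nonneg.2 ht1)
    have h4 := mul_le_mul_of_nonneg_left h1 ht0
    simp only [add_mul, Finset.sum_add_distrib, mul_assoc, ← Finset.mul_sum]
    nlinarith

end Bellman

end KLRobustMDP

/-! ### Memory layout -/

namespace KLRobustMDP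

open RealRAM

/-- The contents of the memory while the Bellman program runs: the loop counters `s`, `a`, `j`,
its real scratch variables, and the output array. -/
structure Env where
  s : ℕ
  a : ℕ
  j : ℕ
  /-- largest payoff in state `s` -/
  bound : ℝ
  /-- smallest nominal probability in state `s` -/
  qmin : ℝ
  /-- largest over the actions of the smallest payoffs -/
  base : ℝ
  /-- lower end of the bracket of the robust value -/
  lo : ℝ
  /-- upper end of the bracket of the robust value -/
  hi : ℝ
  /-- candidate for the robust value -/
  β : ℝ
  /-- sum of the dual values -/
  total : ℝ
  /-- lower end of the bracket of the multiplier -/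
  θlo : ℝ
  /-- upper end of the bracket of the multiplier -/
  θhi : ℝ
  /-- partition function at `θlo` -/
  Zlo : ℝ
  /-- candidate for the multiplier -/
  θ : ℝ
  /-- partial sum of the partition function at `θ` -/
  Z : ℝ
  /-- partial sum of the tilted sum at `θ` -/
  W : ℝ
  /-- smallest payoff of the current action -/
  least : ℝ
  out : ℕ → ℝ

/-- The scratch array. -/
def Env.scratch (e : Env) : ℕ → ℝ
  | 0 => e.bound
  | 1 => e.qmin
  | 2 => e.base
  | 3 => e.lo
  | 4 => e.hi
  | 5 => e.β
  | 6 => e.total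
  | 7 => e.θlo
  | 8 => e.θhi
  | 9 => e.Zlo
  | 10 => e.θ
  | 11 => e.Z
  | 12 => e.W
  | 13 => e.least
  | _ => 0

section Memory

variable {S A : ℕ} (M : KLRobustMDP S A) (v : Fin S → ℝ) (ε : ℝ)

/-- The machine state that stores `e`. The counters stand in the registers `2`, `3`, `4`, the
scratch variables in array `5`, and arrays `0` to `3` hold the input. -/
noncomputable def Env.toState (e : Env) : State where
  idx i := match i with
    | 0 => S
    | 1 => A
    | 2 => e.s
    | 3 => e.a
    | 4 => e.j
    | _ => 0
  mem k i := match k with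
    | 4 => e.out i
    | 5 => e.scratch i
    | k => (M.input v ε).mem k i

variable (e : Env)

/-- The entry of array `2` at position `j`. -/
noncomputable def valueAt (j : ℕ) : ℝ := if h : j < S then v ⟨j, h⟩ else 0

@[simp]
theorem toState_idx_0 : (e.toState M v ε).idx 0 = S := rfl

@[simp]
theorem toState_idx_1 : (e.toState M v ε).idx 1 = A := rfl

@[simp]
theorem toState_idx_2 : (e.toState M v ε).idx 2 = e.s := rfl

@[simp]
theorem toState_idx_3 : (e.toState M v ε).idx 3 = e.a := rfl

@[simp]
theorem toState_idx_4 : (e.toState M v ε).idx 4 = e.j := rfl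

@[simp]
theorem toState_mem_0 (i : ℕ) : (e.toState M v ε).mem 0 i = flatten M.nominal i := rfl

@[simp]
theorem toState_mem_1 (i : ℕ) : (e.toState M v ε).mem 1 i = flatten M.reward i := rfl

@[simp]
theorem toState_mem_2 (i : ℕ) : (e.toState M v ε).mem 2 i = valueAt v i := rfl

@[simp]
theorem toState_mem_3_0 : (e.toState M v ε).mem 3 0 = M.discount := rfl

@[simp]
theorem toState_mem_3_1 : (e.toState M v ε).mem 3 1 = M.budget := rfl

@[simp]
theorem toState_mem_3_2 : (e.toState M v ε).mem 3 2 = ε := rfl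

@[simp]
theorem toState_mem_5_0 : (e.toState M v ε).mem 5 0 = e.bound := rfl

@[simp]
theorem toState_mem_5_1 : (e.toState M v ε).mem 5 1 = e.qmin := rfl

@[simp]
theorem toState_mem_5_2 : (e.toState M v ε).mem 5 2 = e.base := rfl

@[simp]
theorem toState_mem_5_3 : (e.toState M v ε).mem 5 3 = e.lo := rfl

@[simp]
theorem toState_mem_5_4 : (e.toState M v ε).mem 5 4 = e.hi := rfl

@[simp]
theorem toState_mem_5_5 : (e.toState M v ε).mem 5 5 = e.β := rfl

@[simp]
theorem toState_mem_5_6 : (e.toState M v ε).mem 5 6 = e.total := rfl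

@[simp]
theorem toState_mem_5_7 : (e.toState M v ε).mem 5 7 = e.θlo := rfl

@[simp]
theorem toState_mem_5_8 : (e.toState M v ε).mem 5 8 = e.θhi := rfl

@[simp]
theorem toState_mem_5_9 : (e.toState M v ε).mem 5 9 = e.Zlo := rfl

@[simp]
theorem toState_mem_5_10 : (e.toState M v ε).mem 5 10 = e.θ := rfl

@[simp]
theorem toState_mem_5_11 : (e.toState M v ε).mem 5 11 = e.Z := rfl

@[simp]
theorem toState_mem_5_12 : (e.toState M v ε).mem 5 12 = e.W := rfl

@[simp]
theorem toState_mem_5_13 : (e.toState M v ε).mem 5 13 = e.least := rfl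

@[simp]
theorem toState_writeIdx_2 (n : ℕ) :
    (e.toState M v ε).writeIdx 2 n = Env.toState M v ε { e with s := n } := by
  simp only [State.writeIdx, Env.toState, State.mk.injEq]
  refine ⟨?_, rfl⟩
  funext i
  match i with
  | 0 | 1 | 2 | 3 | 4 => rfl
  | i + 5 => exact Function.update_of_ne (by omega) _ _

@[simp]
theorem toState_writeIdx_3 (n : ℕ) :
    (e.toState M v ε).writeIdx 3 n = Env.toState M v ε { e with a := n } := by
  simp only [State.writeIdx, Env.toState, State.mk.injEq]
  refine ⟨?_, rfl⟩
  funext i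
  match i with
  | 0 | 1 | 2 | 3 | 4 => rfl
  | i + 5 => exact Function.update_of_ne (by omega) _ _

@[simp]
theorem toState_writeIdx_4 (n : ℕ) :
    (e.toState M v ε).writeIdx 4 n = Env.toState M v ε { e with j := n } := by
  simp only [State.writeIdx, Env.toState, State.mk.injEq]
  refine ⟨?_, rfl⟩
  funext i
  match i with
  | 0 | 1 | 2 | 3 | 4 => rfl
  | i + 5 => exact Function.update_of_ne (by omega) _ _

@[simp]
theorem toState_writeMem_4 (n : ℕ) (x : ℝ) :
    (e.toState M v ε).writeMem 4 n x =
      Env.toState M v ε { e with out := Function.update e.out n x } := by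
  simp only [State.writeMem, Env.toState, State.mk.injEq, true_and]
  funext k i
  by_cases hk : k = 4
  · subst hk
    rw [Function.update_self]
    rfl
  · rw [Function.update_of_ne hk]
    match k, hk with
    | 0, _ | 1, _ | 2, _ | 3, _ | 5, _ => rfl
    | k + 6, _ => rfl

/-- Writing to one scratch position changes no other memory cell. -/
theorem writeMem_5_eq {e e' : Env} {n : ℕ} {x : ℝ} (hidx : (e'.toState M v ε).idx =
    (e.toState M v ε).idx) (hout : e'.out = e.out) (hn : (e'.toState M v ε).mem 5 n = x)
    (hne : ∀ i, i ≠ n → (e'.toState M v ε).mem 5 i = (e.toState M v ε).mem 5 i) :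
    (e.toState M v ε).writeMem 5 n x = e'.toState M v ε := by
  simp only [State.writeMem]
  have : e'.toState M v ε = ⟨(e'.toState M v ε).idx, (e'.toState M v ε).mem⟩ := rfl
  rw [this, State.mk.injEq]
  refine ⟨hidx.symm, ?_⟩
  funext k i
  by_cases hk : k = 5
  · subst hk
    rw [Function.update_self]
    by_cases hi : i = n
    · rw [hi, Function.update_self, hn]
    · rw [Function.update_of_ne hi, hne i hi]
  · rw [Function.update_of_ne hk]
    match k, hk with
    | 0, _ | 1, _ | 2, _ | 3, _ => rfl
    | 4, _ => exact congrFun hout.symm i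
    | k + 6, _ => rfl

@[simp]
theorem toState_writeMem_5_0 (x : ℝ) :
    (e.toState M v ε).writeMem 5 0 x = Env.toState M v ε { e with bound := x } :=
  writeMem_5_eq M v ε rfl rfl rfl fun i hi => match i, hi with
    | 1, _ | 2, _ | 3, _ | 4, _ | 5, _ | 6, _ | 7, _
    | 8, _ | 9, _ | 10, _ | 11, _ | 12, _ | 13, _ => rfl
    | _ + 14, _ => rfl

@[simp]
theorem toState_writeMem_5_1 (x : ℝ) :
    (e.toState M v ε).writeMem 5 1 x = Env.toState M v ε { e with qmin := x } :=
  writeMem_5_eq M v ε rfl rfl rfl fun i hi => match i, hi with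
    | 0, _ | 2, _ | 3, _ | 4, _ | 5, _ | 6, _ | 7, _
    | 8, _ | 9, _ | 10, _ | 11, _ | 12, _ | 13, _ => rfl
    | _ + 14, _ => rfl

@[simp]
theorem toState_writeMem_5_2 (x : ℝ) :
    (e.toState M v ε).writeMem 5 2 x = Env.toState M v ε { e with base := x } :=
  writeMem_5_eq M v ε rfl rfl rfl fun i hi => match i, hi with
    | 0, _ | 1, _ | 3, _ | 4, _ | 5, _ | 6, _ | 7, _
    | 8, _ | 9, _ | 10, _ | 11, _ | 12, _ | 13, _ => rfl
    | _ + 14, _ => rfl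

@[simp]
theorem toState_writeMem_5_3 (x : ℝ) :
    (e.toState M v ε).writeMem 5 3 x = Env.toState M v ε { e with lo := x } :=
  writeMem_5_eq M v ε rfl rfl rfl fun i hi => match i, hi with
    | 0, _ | 1, _ | 2, _ | 4, _ | 5, _ | 6, _ | 7, _
    | 8, _ | 9, _ | 10, _ | 11, _ | 12, _ | 13, _ => rfl
    | _ + 14, _ => rfl

@[simp]
theorem toState_writeMem_5_4 (x : ℝ) :
    (e.toState M v ε).writeMem 5 4 x = Env.toState M v ε { e with hi := x } :=
  writeMem_5_eq M v ε rfl rfl rfl fun i hi => match i, hi with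
    | 0, _ | 1, _ | 2, _ | 3, _ | 5, _ | 6, _ | 7, _
    | 8, _ | 9, _ | 10, _ | 11, _ | 12, _ | 13, _ => rfl
    | _ + 14, _ => rfl

@[simp]
theorem toState_writeMem_5_5 (x : ℝ) :
    (e.toState M v ε).writeMem 5 5 x = Env.toState M v ε { e with β := x } :=
  writeMem_5_eq M v ε rfl rfl rfl fun i hi => match i, hi with
    | 0, _ | 1, _ | 2, _ | 3, _ | 4, _ | 6, _ | 7, _
    | 8, _ | 9, _ | 10, _ | 11, _ | 12, _ | 13, _ => rfl
    | _ + 14, _ => rfl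

@[simp]
theorem toState_writeMem_5_6 (x : ℝ) :
    (e.toState M v ε).writeMem 5 6 x = Env.toState M v ε { e with total := x } :=
  writeMem_5_eq M v ε rfl rfl rfl fun i hi => match i, hi with
    | 0, _ | 1, _ | 2, _ | 3, _ | 4, _ | 5, _ | 7, _
    | 8, _ | 9, _ | 10, _ | 11, _ | 12, _ | 13, _ => rfl
    | _ + 14, _ => rfl

@[simp]
theorem toState_writeMem_5_7 (x : ℝ) :
    (e.toState M v ε).writeMem 5 7 x = Env.toState M v ε { e with θlo := x } :=
  writeMem_5_eq M v ε rfl rfl rfl fun i hi => match i, hi with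
    | 0, _ | 1, _ | 2, _ | 3, _ | 4, _ | 5, _ | 6, _
    | 8, _ | 9, _ | 10, _ | 11, _ | 12, _ | 13, _ => rfl
    | _ + 14, _ => rfl

@[simp]
theorem toState_writeMem_5_8 (x : ℝ) :
    (e.toState M v ε).writeMem 5 8 x = Env.toState M v ε { e with θhi := x } :=
  writeMem_5_eq M v ε rfl rfl rfl fun i hi => match i, hi with
    | 0, _ | 1, _ | 2, _ | 3, _ | 4, _ | 5, _ | 6, _
    | 7, _ | 9, _ | 10, _ | 11, _ | 12, _ | 13, _ => rfl
    | _ + 14, _ => rfl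

@[simp]
theorem toState_writeMem_5_9 (x : ℝ) :
    (e.toState M v ε).writeMem 5 9 x = Env.toState M v ε { e with Zlo := x } :=
  writeMem_5_eq M v ε rfl rfl rfl fun i hi => match i, hi with
    | 0, _ | 1, _ | 2, _ | 3, _ | 4, _ | 5, _ | 6, _
    | 7, _ | 8, _ | 10, _ | 11, _ | 12, _ | 13, _ => rfl
    | _ + 14, _ => rfl

@[simp]
theorem toState_writeMem_5_10 (x : ℝ) :
    (e.toState M v ε).writeMem 5 10 x = Env.toState M v ε { e with θ := x } :=
  writeMem_5_eq M v ε rfl rfl rfl fun i hi => match i, hi with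
    | 0, _ | 1, _ | 2, _ | 3, _ | 4, _ | 5, _ | 6, _
    | 7, _ | 8, _ | 9, _ | 11, _ | 12, _ | 13, _ => rfl
    | _ + 14, _ => rfl

@[simp]
theorem toState_writeMem_5_11 (x : ℝ) :
    (e.toState M v ε).writeMem 5 11 x = Env.toState M v ε { e with Z := x } :=
  writeMem_5_eq M v ε rfl rfl rfl fun i hi => match i, hi with
    | 0, _ | 1, _ | 2, _ | 3, _ | 4, _ | 5, _ | 6, _
    | 7, _ | 8, _ | 9, _ | 10, _ | 12, _ | 13, _ => rfl
    | _ + 14, _ => rfl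

@[simp]
theorem toState_writeMem_5_12 (x : ℝ) :
    (e.toState M v ε).writeMem 5 12 x = Env.toState M v ε { e with W := x } :=
  writeMem_5_eq M v ε rfl rfl rfl fun i hi => match i, hi with
    | 0, _ | 1, _ | 2, _ | 3, _ | 4, _ | 5, _ | 6, _
    | 7, _ | 8, _ | 9, _ | 10, _ | 11, _ | 13, _ => rfl
    | _ + 14, _ => rfl

@[simp]
theorem toState_writeMem_5_13 (x : ℝ) :
    (e.toState M v ε).writeMem 5 13 x = Env.toState M v ε { e with least := x } :=
  writeMem_5_eq M v ε rfl rfl rfl fun i hi => match i, hi with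
    | 0, _ | 1, _ | 2, _ | 3, _ | 4, _ | 5, _ | 6, _
    | 7, _ | 8, _ | 9, _ | 10, _ | 11, _ | 12, _ => rfl
    | _ + 14, _ => rfl

theorem toState_zero :
    M.input v ε = Env.toState M v ε ⟨0, 0, 0, 0, 0, 0, 0, 0, 0, 0, 0, 0, 0, 0, 0, 0, 0, 0⟩ := by
  have h : ∀ τ : State, τ = ⟨τ.idx, τ.mem⟩ := fun _ => rfl
  rw [h (M.input v ε), h (Env.toState M v ε _), State.mk.injEq]
  constructor
  · funext i
    match i with
    | 0 | 1 | 2 | 3 | 4 => rfl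
    | _ + 5 => rfl
  · funext k i
    match k, i with
    | 0, _ | 1, _ | 2, _ | 3, _ | 4, _ => rfl
    | 5, 0 | 5, 1 | 5, 2 | 5, 3 | 5, 4 | 5, 5 | 5, 6 | 5, 7 | 5, 8 | 5, 9 | 5, 10 | 5, 11
    | 5, 12 | 5, 13 => rfl
    | 5, _ + 14 => rfl
    | _ + 6, _ => rfl

variable {M}

theorem flatten_apply (f : Fin S → Fin A → Fin S → ℝ) (s : Fin S) (a : Fin A) (s' : Fin S) :
    flatten f ((s * A + a) * S + s') = f s a s' := by
  have h2 : ((s : ℕ) * A + a) * S + s' =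
      (finProdFinEquiv (finProdFinEquiv (s, a), s') : ℕ) := by
    simp only [finProdFinEquiv_apply_val]
    ring
  have h : ((s : ℕ) * A + a) * S + s' < S * A * S := h2 ▸ Fin.is_lt _
  have h3 : (⟨_, h⟩ : Fin (S * A * S)) = finProdFinEquiv (finProdFinEquiv (s, a), s') :=
    Fin.ext h2
  rw [flatten, dif_pos h, h3]
  simp

end Memory

/-! ### The program -/

section Program

/-- The scratch variable at position `n` of array `5`. -/
def var (n : ℕ) : RExp := .get 5 (.const n)

/-- Assignment to a scratch variable. -/
def assign (n : ℕ) (e : RExp) : Prog := .setMem 5 (.const n) e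

/-- Increment of a counter. -/
def incr (i : ℕ) : Prog := .setIdx i (.add (.reg i) (.const 1))

/-- The position of the entry `(s, a, j)`. -/
def cellExp : NExp := .add (.mul (.add (.mul (.reg 2) (.reg 1)) (.reg 3)) (.reg 0)) (.reg 4)

/-- The nominal probability of the current entry. -/
def nominalExp : RExp := .get 0 cellExp

/-- The payoff of the current entry. -/
def payoffExp : RExp :=
  .add (.get 1 cellExp) (.mul (.get 3 (.const 0)) (.get 2 (.reg 4)))

/-- The nominal probability of the current entry times `exp (-θ * payoff)`. -/
def weightExp : RExp :=
  .mul nominalExp (.exp (.sub (.cast (.const 0)) (.mul (var 10) payoffExp)))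

/-- Computes `Z` and `W` at the multiplier `θ` of the current action. -/
def sumLoop : Prog :=
  .seq (.setIdx 4 (.const 0)) <| .seq (assign 11 (.cast (.const 0))) <|
  .seq (assign 12 (.cast (.const 0))) <|
  .loop (.nlt (.reg 4) (.reg 0)) <|
    .seq (assign 11 (.add (var 11) weightExp)) <|
    .seq (assign 12 (.add (var 12) (.mul weightExp payoffExp))) <|
    incr 4

/-- Bisection on the multiplier of the current action, down to a bracket with
`(θhi - θlo) * (2 * A * bound ^ 2) ≤ ε * κ`. -/
def bisectMultiplier : Prog :=
  .loop (.rlt (.mul (.get 3 (.const 2)) (.get 3 (.const 1)))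
      (.mul (.sub (var 8) (var 7))
        (.mul (.mul (.cast (.const 2)) (.cast (.reg 1))) (.mul (var 0) (var 0))))) <|
    .seq (assign 10 (.div (.add (var 7) (var 8)) (.cast (.const 2)))) <|
    .seq sumLoop <|
    .ite (.rle (.mul (var 5) (var 11)) (var 12))
      (.seq (assign 7 (var 10)) (assign 9 (var 11)))
      (assign 8 (var 10))

/-- Adds the approximate dual value of the current action to `total`. -/
def addDualValue : Prog :=
  .seq (assign 7 (.cast (.const 0))) <| .seq (assign 9 (.cast (.const 1))) <|
  .seq (assign 8 (.div (.sub (.cast (.const 0)) (.log (var 1))) (.sub (var 5) (var 2)))) <|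
  .seq bisectMultiplier <|
  .seq (assign 6 (.add (var 6)
    (.sub (.sub (.cast (.const 0)) (.mul (var 7) (var 5))) (.log (var 9))))) <|
  incr 3

/-- Halves the bracket of the robust value: its midpoint becomes the lower end if the dual
values add up to the budget, and the upper end otherwise. -/
def halveBracket : Prog :=
  .seq (assign 5 (.div (.add (var 3) (var 4)) (.cast (.const 2)))) <|
  .seq (assign 6 (.cast (.const 0))) <| .seq (.setIdx 3 (.const 0)) <|
  .seq (.loop (.nlt (.reg 3) (.reg 1)) addDualValue) <|
  .ite (.rle (.get 3 (.const 1)) (var 6)) (assign 3 (var 5)) (assign 4 (var 5))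

/-- Bisection on the robust value, down to a bracket with `2 * (hi - lo) ≤ ε`. -/
def bisectValue : Prog :=
  .loop (.rlt (.get 3 (.const 2)) (.mul (.cast (.const 2)) (.sub (var 4) (var 3)))) halveBracket

/-- Replaces a scratch variable by its maximum with `e`. -/
def setMax (n : ℕ) (e : RExp) : Prog := .ite (.rlt (var n) e) (assign n e) .skip

/-- Replaces a scratch variable by its minimum with `e`. -/
def setMin (n : ℕ) (e : RExp) : Prog := .ite (.rlt e (var n)) (assign n e) .skip

/-- Updates the extreme values with the payoffs and probabilities of the current action. -/
def scanAction : Prog :=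
  .seq (.setIdx 4 (.const 0)) <| .seq (assign 13 payoffExp) <|
  .seq (.loop (.nlt (.reg 4) (.reg 0)) <|
    .seq (setMax 0 payoffExp) <|
    .seq (setMin 1 nominalExp) <|
    .seq (setMin 13 payoffExp) <|
    incr 4) <|
  .seq (setMax 2 (var 13)) <|
  incr 3

/-- Computes `bound`, `qmin` and `base` of the current state. -/
def scanState : Prog :=
  .seq (assign 0 (.cast (.const 0))) <| .seq (assign 1 (.cast (.const 1))) <|
  .seq (assign 2 (.cast (.const 0))) <| .seq (.setIdx 3 (.const 0)) <|
  .loop (.nlt (.reg 3) (.reg 1)) scanAction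

/-- Computes the robust value of the current state and goes on to the next one. -/
def solveState : Prog :=
  .seq scanState <| .seq (assign 3 (var 2)) <| .seq (assign 4 (var 0)) <|
  .seq bisectValue <| .seq (.setMem 4 (.reg 2) (var 3)) <| incr 2

/-- The program that computes the robust Bellman operator. -/
def bellmanProg : Prog := .loop (.nlt (.reg 2) (.reg 0)) solveState

end Program

section Verification

attribute [local simp] NExp.eval RExp.eval Test.Holds NExp.cost RExp.cost Test.cost
  var assign incr cellExp nominalExp payoffExp weightExp

variable {S A : ℕ} {M : KLRobustMDP S A} {v : Fin S → ℝ} {ε : ℝ}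

/-! ### Verification of the bisections -/

theorem valueAt_apply (j : Fin S) : valueAt v j = v j := by
  simp [valueAt]

theorem runs_sumLoop {e : Env} {s : Fin S} {a : Fin A} (hs : e.s = s) (ha : e.a = a) :
    Runs sumLoop (e.toState M v ε) fun σ t =>
      σ = Env.toState M v ε { e with
        j := S
        Z := partitionFn (M.nominal s a) (M.payoff v s a) e.θ
        W := tiltedSum (M.nominal s a) (M.payoff v s a) e.θ } ∧
      t ≤ 200 * (S + 1) := by
  set b : ℕ → ℝ := fun j => flatten M.reward ((e.s * A + e.a) * S + j) +
    M.discount * valueAt v j with hb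
  set w : ℕ → ℝ := fun j => flatten M.nominal ((e.s * A + e.a) * S + j) *
    Real.exp (-(e.θ * b j)) with hw
  simp [sumLoop]
  refine (runs_loop (fun k σ => k ≤ S ∧ σ = Env.toState M v ε { e with
    j := k, Z := ∑ j ∈ Finset.range k, w j, W := ∑ j ∈ Finset.range k, w j * b j })
    S 150 ?_ ?_ ?_).mono ?_
  · simp
  · rintro k _ hk ⟨-, rfl⟩ -
    simp [Finset.sum_range_succ, hb, hw]
    exact hk
  · rintro _ ⟨-, rfl⟩
    simp
  · rintro _ t ⟨⟨k, -, hk, rfl⟩, hlt, ht⟩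
    simp at hlt ht ⊢
    obtain rfl : k = S := by omega
    refine ⟨?_, by omega⟩
    congr 2
    · rw [Finset.sum_range, partitionFn]
      simp only [hw, hb, hs, ha, flatten_apply, valueAt_apply, payoff]
    · rw [Finset.sum_range, tiltedSum]
      simp only [hw, hb, hs, ha, flatten_apply, valueAt_apply, payoff]

/-- The brackets that the bisection on the multiplier maintains: the tilted mean is at most `β`
at `hi`, and at least `β` at `lo` unless `lo = 0`. -/
structure Brackets (q b : Fin S → ℝ) (β lo hi : ℝ) : Prop where
  nonneg : 0 ≤ lo
  le : lo ≤ hi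
  lower : lo = 0 ∨ β * partitionFn q b lo ≤ tiltedSum q b lo
  upper : tiltedSum q b hi ≤ β * partitionFn q b hi

/-- `σ` agrees with `e` up to the variables that `bisectMultiplier` changes, and brackets the
multiplier of action `a` by an interval of length at most `g`. -/
def MultiplierBracketed (M : KLRobustMDP S A) (v : Fin S → ℝ) (ε : ℝ) (s : Fin S) (a : Fin A)
    (e : Env) (g : ℝ) (σ : State) : Prop :=
  ∃ j x y θ z w, Brackets (M.nominal s a) (M.payoff v s a) e.β x y ∧ y - x ≤ g ∧
    σ = Env.toState M v ε { e with
      j := j, θlo := x, θhi := y, θ := θ, Z := z, W := w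
      Zlo := partitionFn (M.nominal s a) (M.payoff v s a) x }

theorem runs_bisectMultiplier {e : Env} {s : Fin S} {a : Fin A} (hs : e.s = s) (ha : e.a = a)
    (hbound : 0 < e.bound)
    (hZ : e.Zlo = partitionFn (M.nominal s a) (M.payoff v s a) e.θlo)
    (hbr : Brackets (M.nominal s a) (M.payoff v s a) e.β e.θlo e.θhi) (K : ℕ)
    (hK : (e.θhi - e.θlo) * (2 * A * (e.bound * e.bound)) ≤ 2 ^ K * (ε * M.budget)) :
    Runs bisectMultiplier (e.toState M v ε) fun σ t =>
      MultiplierBracketed M v ε s a e (ε * M.budget / (2 * A * (e.bound * e.bound))) σ ∧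
      t ≤ (K + 1) * (400 * (S + 1)) := by
  have hA : (0 : ℝ) < A := by exact_mod_cast a.pos
  refine (runs_loop (fun k σ => MultiplierBracketed M v ε s a e ((e.θhi - e.θlo) / 2 ^ k) σ)
    K (200 * (S + 1) + 100) ?_ ?_ ?_).mono ?_
  · exact ⟨e.j, e.θlo, e.θhi, e.θ, e.Z, e.W, hbr, by simp, by rw [← hZ]⟩
  · rintro k _ - ⟨j, x, y, θ, z, w, hxy, hk, rfl⟩ -
    simp
    refine (runs_sumLoop (s := s) (a := a) (by exact hs) (by exact ha)).mono ?_
    rintro _ t ⟨rfl, ht⟩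
    have h1 := hxy.nonneg
    have h2 := hxy.le
    have h3 : (y - x) / 2 ≤ (e.θhi - e.θlo) / 2 ^ (k + 1) := by
      rw [pow_succ, ← div_div]
      linarith
    simp
    constructor
    · intro h
      exact ⟨⟨_, (x + y) / 2, y, _, _, _, ⟨by linarith, by linarith, .inr h, hxy.upper⟩,
        by linarith, rfl⟩, by omega⟩
    · intro h
      exact ⟨⟨_, x, (x + y) / 2, _, _, _, ⟨h1, by linarith, hxy.lower, h.le⟩,
        by linarith, rfl⟩, by omega⟩
  · rintro _ ⟨j, x, y, θ, z, w, hxy, hk, rfl⟩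
    simp
    refine (mul_le_mul_of_nonneg_right hk (by positivity)).trans ?_
    rw [div_mul_eq_mul_div, div_le_iff₀ (by positivity)]
    linarith
  · rintro _ t ⟨⟨k, -, j, x, y, θ, z, w, hxy, hk, rfl⟩, hlt, ht⟩
    simp at hlt ht ⊢
    refine ⟨⟨j, x, y, θ, z, w, hxy, ?_, rfl⟩, ?_⟩
    · rwa [le_div_iff₀ (by positivity)]
    · nlinarith

/-- What `scanState` establishes about the extreme values of state `s`. -/
structure Scanned (M : KLRobustMDP S A) (v : Fin S → ℝ) (s : Fin S)
    (bound qmin base : ℝ) : Prop where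
  payoff_le : ∀ a s', M.payoff v s a s' ≤ bound
  bound_nonneg : 0 ≤ bound
  bound_le : bound ≤ M.rewardBound
  qmin_pos : 0 < qmin
  qmin_le_one : qmin ≤ 1
  qmin_le : ∀ a s', qmin ≤ M.nominal s a s'
  minNominal_le : M.minNominal ≤ qmin
  base_nonneg : 0 ≤ base
  base_le_bellman : base ≤ M.bellman v s
  exists_le_base : ∀ a, ∃ s', M.payoff v s a s' ≤ base

/-- `x` is the dual value of action `a` at some multiplier, and some distribution with mean payoff
at most `β` has a divergence that exceeds `x` by at most `δ / A`. -/
def Multiplier (M : KLRobustMDP S A) (v : Fin S → ℝ) (s : Fin S) (δ β : ℝ) (a : Fin A)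
    (x : ℝ) : Prop :=
  ∃ θ, 0 ≤ θ ∧ x = dualValue (M.nominal s a) (M.payoff v s a) β θ ∧
    ∃ p ∈ stdSimplex ℝ (Fin S), ∑ s', p s' * M.payoff v s a s' ≤ β ∧
      klDistance p (M.nominal s a) ≤ x + δ / A

/-- `σ` agrees with `e` up to the variables that `addDualValue` changes, and its `total` has
grown by the dual value of a multiplier of action `a`. -/
def DualValueAdded (M : KLRobustMDP S A) (v : Fin S → ℝ) (ε : ℝ) (s : Fin S) (a : Fin A)
    (e : Env) (σ : State) : Prop :=
  ∃ x, Multiplier M v s (ε * M.budget / (2 * e.bound)) e.β a x ∧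
    ∃ j θlo θhi Zlo θ Z W, σ = Env.toState M v ε { e with
      a := e.a + 1, total := e.total + x
      j := j, θlo := θlo, θhi := θhi, Zlo := Zlo, θ := θ, Z := Z, W := W }

theorem runs_addDualValue {e : Env} {s : Fin S} {a : Fin A} (hs : e.s = s) (ha : e.a = a)
    (hpay : ∀ a s', 0 ≤ M.payoff v s a s')
    (hsc : Scanned M v s e.bound e.qmin e.base) (hβ : e.base < e.β) (hbound : 0 < e.bound) (K : ℕ)
    (hK : -Real.log e.qmin / (e.β - e.base) * (2 * A * (e.bound * e.bound)) ≤
      2 ^ K * (ε * M.budget)) :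
    Runs addDualValue (e.toState M v ε) fun σ t =>
      DualValueAdded M v ε s a e σ ∧ t ≤ (K + 1) * (600 * (S + 1)) := by
  have hq := M.nominal_mem s a
  have hq0 := M.nominal_pos s a
  have hθ0 : 0 ≤ -Real.log e.qmin / (e.β - e.base) :=
    div_nonneg (neg_nonneg.2 (Real.log_nonpos hsc.qmin_pos.le hsc.qmin_le_one)) (by linarith)
  obtain ⟨i, hi⟩ := hsc.exists_le_base a
  simp [addDualValue]
  refine (runs_bisectMultiplier (s := s) (a := a) (by exact hs) (by exact ha)
    (by exact hbound) (by simp [partitionFn_zero hq]) ⟨le_rfl, hθ0, .inl rfl, ?_⟩ K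
    (by simpa using hK)).mono ?_
  · refine tiltedSum_le_of_log_le hq hq0 hθ0 hsc.qmin_pos (hsc.qmin_le a i) hi hβ (le_of_eq ?_)
    have : e.β - e.base ≠ 0 := by linarith
    field_simp
  · rintro _ t ⟨⟨j, x, y, θ, z, w, hxy, hgap, rfl⟩, ht⟩
    simp
    refine ⟨⟨_, ⟨x, hxy.nonneg, rfl, ?_⟩, j, x, y,
      partitionFn (M.nominal s a) (M.payoff v s a) x, θ, z, w, ?_⟩, ?_⟩
    · refine exists_klDistance_le_dualValue_add hq hq0 (hpay a) (hsc.payoff_le a)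
        (hsc.base_nonneg.trans hβ.le) hxy.le hxy.lower hxy.upper ?_
      have hA : (0 : ℝ) < A := by exact_mod_cast a.pos
      refine (mul_le_mul_of_nonneg_left hgap hbound.le).trans (le_of_eq ?_)
      simp only
      field_simp
    · simp [dualValue]
    · nlinarith

/-- `σ` agrees with `e` up to the variables that `addDualValue` changes, and its `total` is
the sum of dual values of multipliers of the actions below `k`. -/
def DualValuesSummed (M : KLRobustMDP S A) (v : Fin S → ℝ) (ε : ℝ) (s : Fin S)
    (e : Env) (k : ℕ) (σ : State) : Prop :=
  ∃ G : ℕ → ℝ, (∀ a : Fin A, (a : ℕ) < k →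
      Multiplier M v s (ε * M.budget / (2 * e.bound)) e.β a (G a)) ∧
    k ≤ A ∧ ∃ j θlo θhi Zlo θ Z W, σ = Env.toState M v ε { e with
      a := k, total := ∑ a ∈ Finset.range k, G a
      j := j, θlo := θlo, θhi := θhi, Zlo := Zlo, θ := θ, Z := Z, W := W }

theorem runs_sumDualValues {e : Env} {s : Fin S} (hs : e.s = s) (ha : e.a = 0)
    (htot : e.total = 0) (hpay : ∀ a s', 0 ≤ M.payoff v s a s')
    (hsc : Scanned M v s e.bound e.qmin e.base) (hβ : e.base < e.β) (hbound : 0 < e.bound) (K : ℕ)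
    (hK : -Real.log e.qmin / (e.β - e.base) * (2 * A * (e.bound * e.bound)) ≤
      2 ^ K * (ε * M.budget)) :
    Runs (.loop (.nlt (.reg 3) (.reg 1)) addDualValue) (e.toState M v ε) fun σ t =>
      DualValuesSummed M v ε s e A σ ∧ t ≤ (A + 1) * ((K + 1) * (603 * (S + 1))) := by
  refine (runs_loop (fun k σ => DualValuesSummed M v ε s e k σ)
    A ((K + 1) * (600 * (S + 1))) ?_ ?_ ?_).mono ?_
  · exact ⟨0, by simp, by simp, e.j, e.θlo, e.θhi, e.Zlo, e.θ, e.Z, e.W,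
      by rw [Finset.range_zero, Finset.sum_empty, ← ha, ← htot]⟩
  · rintro k _ hk ⟨G, hG, -, j, θlo, θhi, Zlo, θ, Z, W, rfl⟩ -
    refine (runs_addDualValue (s := s) (a := ⟨k, hk⟩) (by exact hs) rfl hpay (by exact hsc)
      (by exact hβ) (by exact hbound) K (by exact hK)).mono ?_
    rintro _ t ⟨⟨x, hx, j', θlo', θhi', Zlo', θ', Z', W', rfl⟩, ht⟩
    refine ⟨⟨Function.update G k x, ?_, hk, j', θlo', θhi', Zlo', θ', Z', W', ?_⟩, ht⟩
    · intro a ha'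
      by_cases hak : (a : ℕ) = k
      · obtain rfl : a = ⟨k, hk⟩ := Fin.ext hak
        simpa using hx
      · rw [Function.update_of_ne hak]
        exact hG a (by omega)
    · rw [Finset.sum_range_succ, Function.update_self, Finset.sum_congr rfl fun i hi =>
        Function.update_of_ne (Finset.mem_range.1 hi).ne x G]
  · rintro _ ⟨G, hG, -, j, θlo, θhi, Zlo, θ, Z, W, rfl⟩
    simp
  · rintro _ t ⟨⟨k, -, G, hG, hk, j, θlo, θhi, Zlo, θ, Z, W, rfl⟩, hlt, ht⟩
    simp at hlt ht
    obtain rfl : k = A := by omega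
    refine ⟨⟨G, hG, le_rfl, j, θlo, θhi, Zlo, θ, Z, W, rfl⟩, ht.trans ?_⟩
    have h1 : 1 ≤ (K + 1) * (S + 1) := Nat.succ_le_of_lt (by positivity)
    nlinarith [Nat.mul_le_mul_left k h1]

/-- `σ` agrees with `e` up to the variables that `bisectValue` changes, and brackets the robust
value of state `s` by an interval of length at most `g`. The upper end may be violated by half
the tolerance. -/
def ValueBracketed (M : KLRobustMDP S A) (v : Fin S → ℝ) (ε : ℝ) (s : Fin S)
    (e : Env) (g : ℝ) (σ : State) : Prop :=
  ∃ lo hi a j β total θlo θhi Zlo θ Z W,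
    (e.base ≤ lo ∧ lo ≤ hi ∧ hi ≤ e.bound ∧ lo ≤ M.bellman v s ∧
      M.bellman v s ≤ hi + ε / 2 ∧ hi - lo ≤ g) ∧
    σ = Env.toState M v ε { e with
      lo := lo, hi := hi, a := a, j := j, β := β, total := total
      θlo := θlo, θhi := θhi, Zlo := Zlo, θ := θ, Z := Z, W := W }

theorem runs_halveBracket {e : Env} {s : Fin S} (hs : e.s = s) (hA : 0 < A) (hε : 0 < ε)
    (hpay : ∀ a s', 0 ≤ M.payoff v s a s')
    (hsc : Scanned M v s e.bound e.qmin e.base) (K : ℕ)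
    (hK : -Real.log e.qmin * (8 * A * (e.bound * e.bound)) ≤ 2 ^ K * (ε ^ 2 * M.budget))
    (hbase : e.base ≤ e.lo) (hgap : ε < 2 * (e.hi - e.lo)) (hhi : e.hi ≤ e.bound)
    (hlo : e.lo ≤ M.bellman v s) (hJ : M.bellman v s ≤ e.hi + ε / 2) :
    Runs halveBracket (e.toState M v ε) fun σ t =>
      ValueBracketed M v ε s e ((e.hi - e.lo) / 2) σ ∧
        t ≤ (A + 1) * ((K + 1) * (700 * (S + 1))) := by
  -- the bracket is still longer than `ε / 2`, and its lower end is at least `base`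
  have hβ : ε / 4 ≤ (e.lo + e.hi) / 2 - e.base := by linarith
  have hβ0 : 0 < (e.lo + e.hi) / 2 - e.base := by linarith
  have hbase0 := hsc.base_nonneg
  have hbound : 0 < e.bound := by linarith
  have hlog : 0 ≤ -Real.log e.qmin :=
    neg_nonneg.2 (Real.log_nonpos hsc.qmin_pos.le hsc.qmin_le_one)
  have hκ := M.budget_pos
  simp [halveBracket]
  refine (runs_sumDualValues (s := s) (by exact hs) rfl rfl hpay (by exact hsc)
    (by simpa using sub_pos.1 hβ0) (by exact hbound) K ?_).mono ?_
  · simp only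
    rw [div_mul_eq_mul_div, div_le_iff₀ hβ0]
    have h1 : 2 ^ K * (ε * M.budget) * (ε / 4) ≤
        2 ^ K * (ε * M.budget) * ((e.lo + e.hi) / 2 - e.base) :=
      mul_le_mul_of_nonneg_left hβ (by positivity)
    linarith
  · rintro _ t ⟨⟨G, hG, -, j, θlo, θhi, Zlo, θ, Z, W, rfl⟩, ht⟩
    have htime : 33 ≤ (A + 1) * ((K + 1) * (97 * (S + 1))) := by
      have h1 : 1 ≤ (A + 1) * ((K + 1) * (S + 1)) := Nat.succ_le_of_lt (by positivity)
      linarith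
    simp only [Finset.sum_range] at hG ⊢
    simp
    choose θ' hθ0 hθ p hp hpβ hpkl using fun a => hG a a.2
    constructor
    · intro h
      refine ⟨⟨(e.lo + e.hi) / 2, e.hi, A, j, (e.lo + e.hi) / 2, _, θlo, θhi, Zlo, θ, Z, W,
        ⟨by linarith, by linarith, hhi, ?_, hJ, by linarith⟩, rfl⟩, by linarith⟩
      refine le_bellman_of_budget_le hpay hθ0 (h.trans (le_of_eq ?_))
      exact Finset.sum_congr rfl fun a _ => hθ a
    · intro h
      refine ⟨⟨e.lo, (e.lo + e.hi) / 2, A, j, (e.lo + e.hi) / 2, _, θlo, θhi, Zlo, θ, Z, W,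
        ⟨by linarith, by linarith, by linarith, hlo, ?_, by linarith⟩, rfl⟩, by linarith⟩
      refine bellman_le_of_klDistance_le hpay hA (δ := ε * M.budget / (2 * e.bound))
        hsc.payoff_le (by linarith) (by positivity) (le_of_eq ?_) (by positivity) hp hpβ ?_
      · field_simp
      · have h2 := Finset.sum_le_sum fun a (_ : a ∈ Finset.univ) => hpkl a
        rw [Finset.sum_add_distrib, Finset.sum_const, Finset.card_univ, Fintype.card_fin,
          nsmul_eq_mul, mul_div_cancel₀ _ (by positivity)] at h2
        linarith

theorem runs_bisectValue {e : Env} {s : Fin S} (hs : e.s = s) (hA : 0 < A) (hε : 0 < ε)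
    (hpay : ∀ a s', 0 ≤ M.payoff v s a s')
    (hsc : Scanned M v s e.bound e.qmin e.base) (K L : ℕ)
    (hK : -Real.log e.qmin * (8 * A * (e.bound * e.bound)) ≤ 2 ^ K * (ε ^ 2 * M.budget))
    (hL : 2 * e.bound ≤ 2 ^ L * ε) (hlo : e.lo = e.base) (hhi : e.hi = e.bound)
    (hle : e.base ≤ e.bound) (hJ : M.bellman v s ≤ e.bound) :
    Runs bisectValue (e.toState M v ε) fun σ t =>
      ValueBracketed M v ε s e (ε / 2) σ ∧
        t ≤ (L + 1) * ((A + 1) * ((K + 1) * (800 * (S + 1)))) := by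
  refine (runs_loop (fun k σ => ValueBracketed M v ε s e (e.bound / 2 ^ k) σ)
    L ((A + 1) * ((K + 1) * (700 * (S + 1)))) ?_ ?_ ?_).mono ?_
  · refine ⟨e.lo, e.hi, e.a, e.j, e.β, e.total, e.θlo, e.θhi, e.Zlo, e.θ, e.Z, e.W,
      ⟨hlo.ge, by linarith, hhi.le, hlo ▸ hsc.base_le_bellman, by linarith, ?_⟩, rfl⟩
    have := hsc.base_nonneg
    rw [pow_zero]
    linarith
  · rintro k _ - ⟨lo, hi, a, j, β, total, θlo, θhi, Zlo, θ, Z, W,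
      ⟨h1, h2, h3, h4, h5, h6⟩, rfl⟩ hlt
    simp at hlt
    refine (runs_halveBracket (s := s) (by exact hs) hA hε hpay (by exact hsc) K (by exact hK)
      (by exact h1) (by exact hlt) (by exact h3) (by exact h4) (by exact h5)).mono ?_
    rintro _ t ⟨⟨lo', hi', a', j', β', total', θlo', θhi', Zlo', θ', Z', W',
      ⟨g1, g2, g3, g4, g5, g6⟩, rfl⟩, ht⟩
    refine ⟨⟨lo', hi', a', j', β', total', θlo', θhi', Zlo', θ', Z', W',
      ⟨g1, g2, g3, g4, g5, g6.trans ?_⟩, rfl⟩, ht⟩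
    simp only
    rw [pow_succ, ← div_div]
    linarith
  · rintro _ ⟨lo, hi, a, j, β, total, θlo, θhi, Zlo, θ, Z, W, ⟨h1, h2, h3, h4, h5, h6⟩, rfl⟩
    simp
    have : e.bound / 2 ^ L ≤ ε / 2 := by
      rw [div_le_iff₀ (by positivity)]
      linarith
    linarith
  · rintro _ t ⟨⟨k, -, lo, hi, a, j, β, total, θlo, θhi, Zlo, θ, Z, W,
      ⟨h1, h2, h3, h4, h5, h6⟩, rfl⟩, hlt, ht⟩
    simp at hlt ht
    refine ⟨⟨lo, hi, a, j, β, total, θlo, θhi, Zlo, θ, Z, W,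
      ⟨h1, h2, h3, h4, h5, by linarith⟩, rfl⟩, ht.trans ?_⟩
    have h1 : 1 ≤ (A + 1) * ((K + 1) * (S + 1)) := Nat.succ_le_of_lt (by positivity)
    nlinarith

/-! ### Verification of the scan -/

theorem runs_setMax {n : ℕ} {x : RExp} {σ : State} {R : State → ℕ → Prop}
    (h : ∀ t ≤ 2 * x.cost + 6, R (σ.writeMem 5 n (max (σ.mem 5 n) (x.eval σ))) t) :
    Runs (setMax n x) σ R := by
  simp [setMax]
  constructor
  · intro hlt
    rw [max_eq_right hlt.le] at h
    exact h _ (by omega)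
  · intro hle
    rw [max_eq_left hle] at h
    simpa [State.writeMem] using h _ (by omega)

theorem runs_setMin {n : ℕ} {x : RExp} {σ : State} {R : State → ℕ → Prop}
    (h : ∀ t ≤ 2 * x.cost + 6, R (σ.writeMem 5 n (min (σ.mem 5 n) (x.eval σ))) t) :
    Runs (setMin n x) σ R := by
  simp [setMin]
  constructor
  · intro hlt
    rw [min_eq_right hlt.le] at h
    exact h _ (by omega)
  · intro hle
    rw [min_eq_left hle] at h
    simpa [State.writeMem] using h _ (by omega)

theorem payoff_le_rewardBound (hv : ∀ s, v s ≤ M.rewardBound) (s : Fin S) (a : Fin A)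
    (s' : Fin S) : M.payoff v s a s' ≤ M.rewardBound := by
  have h1 : M.reward s a s' ≤ ⨆ i : Fin S × Fin A × Fin S, M.reward i.1 i.2.1 i.2.2 :=
    le_ciSup (f := fun i : Fin S × Fin A × Fin S => M.reward i.1 i.2.1 i.2.2)
      (Set.finite_range _).bddAbove (s, a, s')
  have h2 : (⨆ i : Fin S × Fin A × Fin S, M.reward i.1 i.2.1 i.2.2) =
      (1 - M.discount) * M.rewardBound := by
    have := M.discount_lt_one
    rw [rewardBound, mul_inv_cancel_left₀ (by linarith)]
  have h3 := mul_le_mul_of_nonneg_left (hv s') M.discount_pos.le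
  rw [payoff]
  linarith

theorem minNominal_le (s : Fin S) (a : Fin A) (s' : Fin S) :
    M.minNominal ≤ M.nominal s a s' :=
  ciInf_le (f := fun i : Fin S × Fin A × Fin S => M.nominal i.1 i.2.1 i.2.2)
    (Set.finite_range _).bddBelow (s, a, s')

theorem nominal_le_one (s : Fin S) (a : Fin A) (s' : Fin S) : M.nominal s a s' ≤ 1 := by
  rw [← (M.nominal_mem s a).2]
  exact Finset.single_le_sum (fun i _ => (M.nominal_pos s a i).le) (Finset.mem_univ s')

theorem minNominal_pos (hS : 0 < S) (hA : 0 < A) : 0 < M.minNominal := by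
  have : Nonempty (Fin S × Fin A × Fin S) := ⟨(⟨0, hS⟩, ⟨0, hA⟩, ⟨0, hS⟩)⟩
  obtain ⟨i, hi⟩ := exists_eq_ciInf_of_finite
    (f := fun i : Fin S × Fin A × Fin S => M.nominal i.1 i.2.1 i.2.2)
  rw [minNominal, ← hi]
  exact M.nominal_pos _ _ _

/-- The smallest payoff of a single action is a lower bound of the robust value. -/
theorem le_bellman_of_le_payoff {s : Fin S} (hpay : ∀ a s', 0 ≤ M.payoff v s a s') (a : Fin A)
    {x : ℝ} (hx : ∀ s', x ≤ M.payoff v s a s') : x ≤ M.bellman v s := by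
  refine le_bellman_of_mem hpay (single_mem_stdSimplex ℝ a) fun p hp => ?_
  rw [Finset.sum_eq_single a (fun b _ hb => by simp [hb]) (by simp), Pi.single_eq_same,
    one_mul]
  calc x = ∑ s', p a s' * x := by rw [← Finset.sum_mul, (hp.1 a).2, one_mul]
    _ ≤ _ := Finset.sum_le_sum fun s' _ => mul_le_mul_of_nonneg_left (hx s') ((hp.1 a).1 s')

/-- `bound` and `qmin` bound the payoffs and probabilities of the pairs in `D`, and lie in the
ranges that all payoffs and probabilities share. -/
structure Extremes (M : KLRobustMDP S A) (v : Fin S → ℝ) (s : Fin S)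
    (D : Fin A → Fin S → Prop) (bound qmin : ℝ) : Prop where
  payoff_le : ∀ a s', D a s' → M.payoff v s a s' ≤ bound
  bound_nonneg : 0 ≤ bound
  bound_le : bound ≤ M.rewardBound
  qmin_le : ∀ a s', D a s' → qmin ≤ M.nominal s a s'
  qmin_pos : 0 < qmin
  qmin_le_one : qmin ≤ 1
  minNominal_le : M.minNominal ≤ qmin

theorem Extremes.insert {s : Fin S} {D D' : Fin A → Fin S → Prop} {bound qmin : ℝ}
    (h : Extremes M v s D bound qmin) (hv : ∀ s, v s ≤ M.rewardBound) (a : Fin A) (j : Fin S)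
    (hD : ∀ a' s', D' a' s' → D a' s' ∨ (a' = a ∧ s' = j)) :
    Extremes M v s D' (max bound (M.payoff v s a j)) (min qmin (M.nominal s a j)) where
  payoff_le a' s' h' := by
    rcases hD a' s' h' with h' | ⟨rfl, rfl⟩
    · exact le_max_of_le_left (h.payoff_le a' s' h')
    · exact le_max_right _ _
  bound_nonneg := le_max_of_le_left h.bound_nonneg
  bound_le := max_le h.bound_le (payoff_le_rewardBound hv s a j)
  qmin_le a' s' h' := by
    rcases hD a' s' h' with h' | ⟨rfl, rfl⟩
    · exact min_le_of_left_le (h.qmin_le a' s' h')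
    · exact min_le_right _ _
  qmin_pos := lt_min h.qmin_pos (M.nominal_pos s a j)
  qmin_le_one := min_le_of_left_le h.qmin_le_one
  minNominal_le := le_min h.minNominal_le (KLRobustMDP.minNominal_le s a j)

/-- `σ` agrees with `e` up to the variables that `scanAction` changes; the first `k` payoffs and
probabilities of action `a` have been scanned. -/
def ActionScanned (M : KLRobustMDP S A) (v : Fin S → ℝ) (ε : ℝ) (s : Fin S) (a : Fin A)
    (e : Env) (k : ℕ) (σ : State) : Prop :=
  ∃ bound qmin least,
    Extremes M v s (fun a' s' => a' < a ∨ (a' = a ∧ (s' : ℕ) < k)) bound qmin ∧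
    (∀ s' : Fin S, (s' : ℕ) < k → least ≤ M.payoff v s a s') ∧
    (∃ s', M.payoff v s a s' ≤ least) ∧ k ≤ S ∧
    σ = Env.toState M v ε { e with j := k, bound := bound, qmin := qmin, least := least }

/-- `base` is a lower bound of the robust value that dominates the smallest payoff of each of
the first `k` actions. -/
structure BaseValue (M : KLRobustMDP S A) (v : Fin S → ℝ) (s : Fin S) (k : ℕ)
    (base : ℝ) : Prop where
  nonneg : 0 ≤ base
  le_bellman : base ≤ M.bellman v s
  exists_le : ∀ a : Fin A, (a : ℕ) < k → ∃ s', M.payoff v s a s' ≤ base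

/-- `σ` agrees with `e` up to the variables that `scanState` changes; the first `k` actions have
been scanned. -/
def ActionsScanned (M : KLRobustMDP S A) (v : Fin S → ℝ) (ε : ℝ) (s : Fin S)
    (e : Env) (k : ℕ) (σ : State) : Prop :=
  ∃ bound qmin base j least, Extremes M v s (fun a' _ => (a' : ℕ) < k) bound qmin ∧
    BaseValue M v s k base ∧ k ≤ A ∧ σ = Env.toState M v ε { e with
      a := k, bound := bound, qmin := qmin, base := base, j := j, least := least }

theorem runs_scanAction {e : Env} {s : Fin S} {a : Fin A} (hs : e.s = s) (ha : e.a = a)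
    (hpay : ∀ a s', 0 ≤ M.payoff v s a s') (hv : ∀ s, v s ≤ M.rewardBound)
    (hext : Extremes M v s (fun a' _ => (a' : ℕ) < a) e.bound e.qmin)
    (hbase : BaseValue M v s a e.base) :
    Runs scanAction (e.toState M v ε) fun σ t =>
      ActionsScanned M v ε s e (a + 1) σ ∧ t ≤ 400 * (S + 1) := by
  have hpayoff : ∀ j : Fin S, flatten M.reward ((e.s * A + e.a) * S + j) +
      M.discount * valueAt v j = M.payoff v s a j := fun j => by
    rw [hs, ha, flatten_apply, valueAt_apply, payoff]
  have hnominal : ∀ j : Fin S, flatten M.nominal ((e.s * A + e.a) * S + j) =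
      M.nominal s a j := fun j => by
    rw [hs, ha, flatten_apply]
  have h0 := hpayoff ⟨0, s.pos⟩
  simp only [add_zero] at h0
  simp [scanAction]
  rw [h0]
  refine (runs_loop (fun k σ => ActionScanned M v ε s a e k σ) S 200 ?_ ?_ ?_).mono ?_
  · refine ⟨e.bound, e.qmin, _, ?_, by simp, ⟨_, le_rfl⟩, by simp, rfl⟩
    simpa using hext
  · rintro k _ hk ⟨bound, qmin, least, hx, hl, ⟨s₀, hs₀⟩, -, rfl⟩ -
    simp
    refine runs_setMax fun t₁ ht₁ => runs_setMin fun t₂ ht₂ => runs_setMin fun t₃ ht₃ => ?_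
    simp at ht₁ ht₂ ht₃ ⊢
    rw [hpayoff ⟨k, hk⟩, hnominal ⟨k, hk⟩]
    refine ⟨⟨_, _, _, hx.insert hv a ⟨k, hk⟩ ?_, ?_, ?_, hk, rfl⟩, by omega⟩
    · rintro a' s' (h | ⟨rfl, h⟩)
      · exact .inl (.inl h)
      · rcases Nat.lt_succ_iff_lt_or_eq.1 h with h | h
        · exact .inl (.inr ⟨rfl, h⟩)
        · exact .inr ⟨rfl, Fin.ext h⟩
    · intro s' h
      rcases Nat.lt_succ_iff_lt_or_eq.1 h with h | h
      · exact min_le_of_left_le (hl s' h)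
      · obtain rfl : s' = ⟨k, hk⟩ := Fin.ext h
        exact min_le_right _ _
    · rcases min_choice least (M.payoff v s a ⟨k, hk⟩) with h | h
      · exact ⟨s₀, by rwa [h]⟩
      · exact ⟨⟨k, hk⟩, h.ge⟩
  · rintro _ ⟨bound, qmin, least, hx, hl, hl', -, rfl⟩
    simp
  · rintro _ t ⟨⟨k, -, bound, qmin, least, hx, hl, ⟨s₀, hs₀⟩, hk, rfl⟩, hlt, ht⟩
    simp at hlt ht ⊢
    refine runs_setMax fun t₁ ht₁ => ?_
    simp at ht₁ ⊢
    rw [ha]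
    refine ⟨⟨bound, qmin, max e.base least, k, least, ?_, ⟨?_, ?_, ?_⟩, a.2, rfl⟩, by omega⟩
    · refine { hx with
        payoff_le := fun a' s' h => hx.payoff_le a' s' ?_
        qmin_le := fun a' s' h => hx.qmin_le a' s' ?_ } <;>
      · rcases Nat.lt_succ_iff_lt_or_eq.1 h with h | h
        · exact .inl h
        · exact .inr ⟨Fin.ext h, by omega⟩
    · exact le_max_of_le_left hbase.nonneg
    · exact max_le hbase.le_bellman
        (le_bellman_of_le_payoff hpay a fun s' => hl s' (by omega))
    · intro a' h
      rcases Nat.lt_succ_iff_lt_or_eq.1 h with h | h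
      · obtain ⟨s', hs'⟩ := hbase.exists_le a' h
        exact ⟨s', le_max_of_le_left hs'⟩
      · obtain rfl : a' = a := Fin.ext h
        exact ⟨s₀, le_max_of_le_right hs₀⟩

theorem runs_scanState {e : Env} {s : Fin S} (hs : e.s = s) (hA : 0 < A)
    (hpay : ∀ s a s', 0 ≤ M.payoff v s a s') (hv : ∀ s, v s ≤ M.rewardBound) :
    Runs scanState (e.toState M v ε) fun σ t =>
      (∃ a j least bound qmin base, Scanned M v s bound qmin base ∧
        σ = Env.toState M v ε { e with
          a := a, j := j, least := least, bound := bound, qmin := qmin, base := base }) ∧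
      t ≤ (A + 1) * (420 * (S + 1)) := by
  have hJ : 0 ≤ M.bellman v s := le_bellman_of_le_payoff (hpay s) ⟨0, hA⟩ (hpay s _)
  have hone : M.minNominal ≤ 1 := (minNominal_le s ⟨0, hA⟩ s).trans (nominal_le_one _ _ _)
  have hR : 0 ≤ M.rewardBound := (hpay s ⟨0, hA⟩ s).trans (payoff_le_rewardBound hv _ _ _)
  simp only [scanState, runs_seq, runs_setIdx, runs_setMem, assign, NExp.eval, RExp.eval,
    toState_writeMem_5_0, toState_writeMem_5_1, toState_writeMem_5_2, toState_writeIdx_3,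
    Nat.cast_zero, Nat.cast_one]
  refine (runs_loop (fun k σ => ActionsScanned M v ε s e k σ) A (400 * (S + 1)) ?_ ?_ ?_).mono ?_
  · exact ⟨0, 1, 0, e.j, e.least, ⟨by simp, le_rfl, hR, by simp, one_pos, le_rfl, hone⟩,
      ⟨le_rfl, hJ, by simp⟩, by simp, rfl⟩
  · rintro k _ hk ⟨bound, qmin, base, j, least, hx, hb, -, rfl⟩ -
    refine (runs_scanAction (s := s) (a := ⟨k, hk⟩) (by exact hs) rfl (hpay s) hv (by exact hx)
      (by exact hb)).mono ?_
    rintro _ t ⟨⟨bound', qmin', base', j', least', hx', hb', hk', rfl⟩, ht⟩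
    exact ⟨⟨bound', qmin', base', j', least', hx', hb', hk', rfl⟩, ht⟩
  · rintro _ ⟨bound, qmin, base, j, least, hx, hb, -, rfl⟩
    simp
  · rintro _ t ⟨⟨k, -, bound, qmin, base, j, least, hx, hb, hk, rfl⟩, hlt, ht⟩
    simp at hlt
    obtain rfl : k = A := by omega
    refine ⟨⟨k, j, least, bound, qmin, base, ?_, rfl⟩, ?_⟩
    · exact ⟨fun a s' => hx.payoff_le a s' a.2, hx.bound_nonneg, hx.bound_le, hx.qmin_pos,
        hx.qmin_le_one, fun a s' => hx.qmin_le a s' a.2, hx.minNominal_le, hb.nonneg,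
        hb.le_bellman, fun a => hb.exists_le a a.2⟩
    · simp at ht ⊢
      nlinarith

/-! ### Verification of the program -/

/-- The state counter of `σ` is `k`, and the first `k` entries of the output array are
correct up to `ε`. -/
def StatesSolved (M : KLRobustMDP S A) (v : Fin S → ℝ) (ε : ℝ) (k : ℕ) (σ : State) : Prop :=
  ∃ e : Env, e.s = k ∧ k ≤ S ∧ (∀ s : Fin S, (s : ℕ) < k → |e.out s - M.bellman v s| ≤ ε) ∧
    σ = e.toState M v ε

theorem runs_solveState {e : Env} {s : Fin S} (hs : e.s = s) (hA : 0 < A) (hε : 0 < ε)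
    (hpay : ∀ s a s', 0 ≤ M.payoff v s a s') (hv : ∀ s, v s ≤ M.rewardBound)
    (hout : ∀ s' : Fin S, (s' : ℕ) < s → |e.out s' - M.bellman v s'| ≤ ε) (K L : ℕ)
    (hK : Real.log M.minNominal⁻¹ * (8 * A * (M.rewardBound * M.rewardBound)) ≤
      2 ^ K * (ε ^ 2 * M.budget))
    (hL : 2 * M.rewardBound ≤ 2 ^ L * ε) :
    Runs solveState (e.toState M v ε) fun σ t =>
      StatesSolved M v ε (s + 1) σ ∧
      t ≤ (L + 1) * ((A + 1) * ((K + 1) * (1300 * (S + 1)))) := by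
  simp only [solveState, runs_seq]
  refine (runs_scanState (s := s) hs hA hpay hv).mono ?_
  rintro _ t ⟨⟨a, j, least, bound, qmin, base, hsc, rfl⟩, ht⟩
  have hJ : M.bellman v s ≤ bound := by
    refine bellman_le_of_mem (hpay s) hA (nominal_mem_ambiguitySet s) fun a => ?_
    calc _ ≤ ∑ s', M.nominal s a s' * bound := Finset.sum_le_sum fun s' _ =>
          mul_le_mul_of_nonneg_left (hsc.payoff_le a s') (M.nominal_pos s a s').le
      _ = bound := by rw [← Finset.sum_mul, (M.nominal_mem s a).2, one_mul]
  simp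
  refine (runs_bisectValue (s := s) (by exact hs) hA hε (hpay s) (by exact hsc) K L ?_ ?_ rfl rfl
    ?_ ?_).mono ?_
  · simp only
    have h0 := hsc.bound_nonneg
    have h1 : 0 ≤ -Real.log qmin :=
      neg_nonneg.2 (Real.log_nonpos hsc.qmin_pos.le hsc.qmin_le_one)
    have h2 : -Real.log qmin ≤ Real.log M.minNominal⁻¹ := by
      rw [Real.log_inv]
      exact neg_le_neg (Real.log_le_log (minNominal_pos s.pos hA) hsc.minNominal_le)
    refine le_trans ?_ hK
    gcongr
    · exact h1.trans h2
    · exact hsc.bound_nonneg.trans hsc.bound_le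
    · exact hsc.bound_le
    · exact hsc.bound_le
  · simp only
    linarith [hsc.bound_le]
  · exact hsc.base_le_bellman.trans hJ
  · exact hJ
  · rintro _ u ⟨⟨lo, hi, a', j', β, total, θlo, θhi, Zlo, θ, Z, W,
      ⟨h1, h2, h3, h4, h5, h6⟩, rfl⟩, hu⟩
    simp
    refine ⟨⟨_, by simp only [hs], s.2, ?_, rfl⟩, ?_⟩
    · intro s' h
      simp only [hs]
      by_cases hne : s' = s
      · subst hne
        rw [Function.update_self, abs_sub_le_iff]
        constructor <;> linarith
      · rw [Function.update_of_ne fun h' => hne (Fin.ext h')]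
        have : (s' : ℕ) ≠ s := fun h' => hne (Fin.ext h')
        exact hout s' (by omega)
    · have h1 : (A + 1) * (420 * (S + 1)) ≤
          (L + 1) * ((A + 1) * ((K + 1) * (420 * (S + 1)))) := by
        calc _ = 1 * ((A + 1) * (1 * (420 * (S + 1)))) := by ring
          _ ≤ _ := by gcongr <;> omega
      have h2 : 1 ≤ (L + 1) * ((A + 1) * ((K + 1) * (S + 1))) :=
        Nat.succ_le_of_lt (by positivity)
      linarith

theorem runs_bellmanProg (hA : 0 < A) (hε : 0 < ε)
    (hpay : ∀ s a s', 0 ≤ M.payoff v s a s') (hv : ∀ s, v s ≤ M.rewardBound) (K L : ℕ)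
    (hK : Real.log M.minNominal⁻¹ * (8 * A * (M.rewardBound * M.rewardBound)) ≤
      2 ^ K * (ε ^ 2 * M.budget))
    (hL : 2 * M.rewardBound ≤ 2 ^ L * ε) :
    Runs bellmanProg (M.input v ε) fun σ t =>
      ‖σ.output S - M.bellman v‖ ≤ ε ∧
      t ≤ (S + 1) * ((L + 1) * ((A + 1) * ((K + 1) * (1310 * (S + 1))))) := by
  rw [toState_zero]
  refine (runs_loop (fun k σ => StatesSolved M v ε k σ) S
    ((L + 1) * ((A + 1) * ((K + 1) * (1300 * (S + 1))))) ?_ ?_ ?_).mono ?_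
  · exact ⟨_, rfl, by simp, by simp, rfl⟩
  · rintro k _ hk ⟨e, hs, -, hout, rfl⟩ -
    exact runs_solveState (s := ⟨k, hk⟩) hs hA hε hpay hv hout K L hK hL
  · rintro _ ⟨e, hs, -, hout, rfl⟩
    simp [hs]
  · rintro _ t ⟨⟨k, -, e, hs, hk, hout, rfl⟩, hlt, ht⟩
    simp [hs] at hlt ht
    obtain rfl : k = S := by omega
    constructor
    · rw [pi_norm_le_iff_of_nonneg hε.le]
      exact fun s => hout s s.2
    · have h1 : 1 ≤ (L + 1) * ((A + 1) * ((K + 1) * (k + 1))) :=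
        Nat.succ_le_of_lt (by positivity)
      nlinarith

end Verification

/-! ### Number of halvings -/

/-- Twice the positive part of the natural logarithm, plus one, suffices as a number of
halvings, since `1 ≤ 2 * log 2`. -/
theorem exists_le_two_pow (x : ℝ) : ∃ K : ℕ, x ≤ 2 ^ K ∧ (K : ℝ) ≤ 1 + 2 * max 0 (Real.log x) := by
  rcases le_or_gt x 1 with hx | hx
  · exact ⟨0, by simpa using hx, by simp; positivity⟩
  · have hlog := Real.log_pos hx
    have h2 := Real.log_two_gt_d9
    refine ⟨⌈Real.log x / Real.log 2⌉₊, ?_, ?_⟩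
    · have h := Nat.le_ceil (Real.log x / Real.log 2)
      rw [div_le_iff₀ (by linarith), ← Real.log_pow] at h
      exact (Real.log_le_log_iff (by linarith) (by positivity)).1 h
    · refine (Nat.ceil_lt_add_one (by positivity)).le.trans ?_
      rw [max_eq_right hlog.le, add_comm, add_le_add_iff_left, div_le_iff₀ (by linarith)]
      nlinarith

end KLRobustMDP

theorem mainTheorem5 :
    ∃ (P : RealRAM.Prog) (C : ℝ), 0 < C ∧
      ∀ (S A : ℕ), 0 < S → 0 < A →
      ∀ (M : KLRobustMDP S A) (v : Fin S → ℝ) (ε : ℝ), 0 < ε →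
        (∀ s a s', 0 ≤ M.reward s a s' + M.discount * v s') →
        (∀ s, v s ≤ M.rewardBound) →
        ∃ (σ : RealRAM.State) (t : ℕ),
          RealRAM.Exec P (M.input v ε) σ t ∧
          ‖σ.output S - M.bellman v‖ ≤ ε ∧
          (t : ℝ) ≤ C * ((S : ℝ) ^ 2 * ((A : ℝ) * max 1 (Real.log A)) *
            max 1 (Real.log
              (M.rewardBound ^ 2 * Real.log (M.minNominal⁻¹) / (ε ^ 2 * M.budget))) *
            max 1 (Real.log (M.rewardBound / ε))) := by
  -- a factor `2` for each of the three increments of `S` and `A`, and `12` and `6` for the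
  -- numbers of inner and outer rounds, as multiples of the logarithmic factors
  refine ⟨KLRobustMDP.bellmanProg, 8 * 1310 * 12 * 6, by norm_num, ?_⟩
  intro S A hS hA M v ε hε hpay hv
  have hκ := M.budget_pos
  set R := M.rewardBound with hR
  set X := R ^ 2 * Real.log (M.minNominal⁻¹) / (ε ^ 2 * M.budget) with hX
  obtain ⟨K, hK1, hK2⟩ := KLRobustMDP.exists_le_two_pow (8 * A * X)
  obtain ⟨L, hL1, hL2⟩ := KLRobustMDP.exists_le_two_pow (2 * (R / ε))
  have hS1 : (1 : ℝ) ≤ S := by exact_mod_cast hS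
  have hA1 : (1 : ℝ) ≤ A := by exact_mod_cast hA
  have hR0 : 0 ≤ R := (hpay ⟨0, hS⟩ ⟨0, hA⟩ ⟨0, hS⟩).trans
    (KLRobustMDP.payoff_le_rewardBound hv _ _ _)
  have hX0 : 0 ≤ X := by
    have h1 : 0 ≤ Real.log M.minNominal⁻¹ := by
      rw [Real.log_inv, neg_nonneg]
      exact Real.log_nonpos (KLRobustMDP.minNominal_pos hS hA).le
        ((KLRobustMDP.minNominal_le ⟨0, hS⟩ ⟨0, hA⟩ ⟨0, hS⟩).trans
          (KLRobustMDP.nominal_le_one _ _ _))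
    positivity
  have hlog2 := Real.log_two_lt_d9
  set a := max 1 (Real.log A) with ha
  set x := max 1 (Real.log X) with hx
  set y := max 1 (Real.log (R / ε)) with hy
  have ha1 : 1 ≤ a := le_max_left _ _
  have hx1 : 1 ≤ x := le_max_left _ _
  have hy1 : 1 ≤ y := le_max_left _ _
  have hK3 : max 0 (Real.log (8 * A * X)) ≤ 5 * (a * x) := by
    have hax : a + x ≤ 1 + a * x := by nlinarith
    refine max_le (by positivity) ?_
    rcases hX0.eq_or_lt with h | h
    · -- a single state, or no rewards: no halving is needed
      rw [← h, mul_zero, Real.log_zero]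
      positivity
    · rw [Real.log_mul (by positivity) h.ne', Real.log_mul (by norm_num) (by positivity),
        show (8 : ℝ) = 2 ^ 3 by norm_num, Real.log_pow]
      have h1 : Real.log A ≤ a := le_max_right _ _
      have h2 : Real.log X ≤ x := le_max_right _ _
      push_cast
      nlinarith
  have hL3 : max 0 (Real.log (2 * (R / ε))) ≤ 2 * y := by
    refine max_le (by positivity) ?_
    rcases hR0.eq_or_lt with h | h
    · -- all rewards are zero
      rw [← h, zero_div, mul_zero, Real.log_zero]
      positivity
    · rw [Real.log_mul (by norm_num) (by positivity)]
      have h1 : Real.log (R / ε) ≤ y := le_max_right _ _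
      linarith
  obtain ⟨σ, t, hE, hout, ht⟩ := KLRobustMDP.runs_bellmanProg hA hε hpay hv K L
    (by
      rw [hX, ← mul_div_assoc, div_le_iff₀ (by positivity)] at hK1
      linarith)
    (by
      rw [← mul_div_assoc, div_le_iff₀ hε] at hL1
      exact hL1)
  refine ⟨σ, t, hE, hout, ?_⟩
  have ht' : (t : ℝ) ≤ (S + 1) * ((L + 1) * ((A + 1) * ((K + 1) * (1310 * (S + 1))))) := by
    exact_mod_cast ht
  have hax1 : 1 ≤ a * x := by nlinarith
  calc (t : ℝ) ≤ (S + 1) * ((L + 1) * ((A + 1) * ((K + 1) * (1310 * (S + 1))))) := ht'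
    _ ≤ (2 * S) * ((6 * y) * ((2 * A) * ((12 * (a * x)) * (1310 * (2 * S))))) := by
        gcongr <;> linarith
    _ = _ := by ring
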